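/- Let $n\in\mathbb N$, $n\ge 1$, $\alpha\in(0,2]$, $\beta>0$, and let $S_{\alpha,\beta}$ be the spectral density of the stationary Gaussian random field on $\mathbb R^n$ with generalized Cauchy covariance $C_{\alpha,\beta}(t)=(1+\|t\|^{\alpha})^{-\beta}$. That is, $S_{\alpha,\beta}$ is the real function, continuous on $\mathbb R^n\setminus\{0\}$, which is the Fourier transform of $C_{\alpha,\beta}$ in the sense of tempered distributions: for every Schwartz function $\psi$, the product $S_{\alpha,\beta}\psi$ is integrable and $$\int_{\mathbb R^n} S_{\alpha,\beta}(\omega)\psi(\omega)\,d\omega=\int_{\mathbb R^n} C_{\alpha,\beta}(t)\hat\psi(t)\,dt,\qquad \hat\psi(t)=\frac1{(2\pi)^n}\int_{\mathbb R^n}e^{-i\omega\cdot t}\psi(\omega)\,d\omega .$$ Such a function exists, and every such function has the following behaviour as $\|\omega\|\to\infty$. (i) If $\alpha\in(0,2)$, then $$S_{\alpha,\beta}(\omega)\sim\frac{1}{\pi^{\frac{n+2}{2}}}\frac1{\Gamma(\beta)}\sum_{j=1}^{\infty}\frac{(-1)^{j-1}2^{\alpha j}}{j!}\,\Gamma(\beta+j)\,\Gamma\Big(\frac{\alpha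 j+n}{2}\Big)\Gamma\Big(\frac{\alpha j+2}{2}\Big)\sin\frac{\pi\alpha j}{2}\;\|\omega\|^{-\alpha j-n}$$ as an asymptotic series: for every $N\ge 0$, the difference of $S_{\alpha,\beta}(\omega)$ and the sum of the terms with $1\le j\le N$ is $O(\|\omega\|^{-\alpha(N+1)-n})$. In particular $S_{\alpha,\beta}(\omega)$ is asymptotically equivalent to $$\frac{2^{\alpha}\beta}{\pi^{\frac{n+2}2}}\Gamma\Big(\frac{\alpha+n}2\Big)\Gamma\Big(\frac{\alpha+2}2\Big)\sin\frac{\pi\alpha}2\;\|\omega\|^{-\alpha-n}.$$ (ii) If $\alpha=2$, then $$S_{2,\beta}(\omega)\sim\frac{\|\omega\|^{\beta-\frac{n+1}{2}}}{2^{\frac{n-1}{2}+\beta}\pi^{\frac{n-1}{2}}\Gamma(\beta)}e^{-\|\omega\|}\sum_{j=0}^{\infty}\frac{1}{(2\|\omega\|)^j}\,\frac{\Gamma\big(\frac{n+1}{2}-\beta+j\big)}{j!\,\Gamma\big(\frac{n+1}{2}-\beta-j\big)}$$ as an asymptotic series: for every $N\ge0$, the difference of $S_{2,\beta}(\omega)$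 and the sum of the terms with $0\le j<N$ is $O\big(\|\omega\|^{\beta-\frac{n+1}{2}-N}e^{-\|\omega\|}\big)$. Here $\Gamma(a+j)/\Gamma(a-j)$ means its continuous extension in $a$, the product $(a-j)(a-j+1)\cdots(a+j-1)$. In particular $$S_{2,\beta}(\omega)\ \text{is asymptotically equivalent to}\ \frac{\|\omega\|^{\beta-\frac{n+1}{2}}}{2^{\frac{n-1}{2}+\beta}\pi^{\frac{n-1}{2}}\Gamma(\beta)}e^{-\|\omega\|}.$$ -/

import Mathlib

open Filter Asymptotics MeasureTheory Topology
open scoped SchwartzMap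

noncomputable section

/-- The generalized Cauchy covariance `C(t) = (1 + ‖t‖ ^ α) ^ (-β)` on `ℝⁿ`. -/
def gcCov (n : ℕ) (α β : ℝ) (t : EuclideanSpace ℝ (Fin n)) : ℝ :=
  (1 + ‖t‖ ^ α) ^ (-β)

/-- The Fourier transform `ψ̂(t) = (2π)⁻ⁿ ∫ exp(-i ω·t) ψ(ω) dω`. -/
def fourierHat {n : ℕ} (ψ : EuclideanSpace ℝ (Fin n) → ℂ) (t : EuclideanSpace ℝ (Fin n)) : ℂ :=
  (1 / (2 * (Real.pi : ℂ)) ^ n) *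
    ∫ ω, Complex.exp (-Complex.I * ((inner ℝ ω t : ℝ) : ℂ)) * ψ ω

/-- `S` is the spectral density of the covariance function `C` on `ℝⁿ`: the Fourier transform of
`C`, taken as a tempered distribution, is the function `S`, that is, `⟨S, ψ⟩ = ⟨C, ψ̂⟩` for every
Schwartz function `ψ` (with an honest integral on the left). This determines `S` almost everywhere;
continuity away from the origin selects the representative whose pointwise values are
meant. If `C` is even and integrable, `ω ↦ (2π)⁻ⁿ ∫ exp(-i ω·t) C(t) dt` is such a function. -/
structure IsSpectralDensity {n : ℕ} (C S : EuclideanSpace ℝ (Fin n) → ℝ) : Prop where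
  continuousOn : ContinuousOn S {0}ᶜ
  integrable : ∀ ψ : 𝓢(EuclideanSpace ℝ (Fin n), ℂ), Integrable (fun ω => (S ω : ℂ) * ψ ω)
  pairing : ∀ ψ : 𝓢(EuclideanSpace ℝ (Fin n), ℂ),
    ∫ ω, (S ω : ℂ) * ψ ω = ∫ t, (C t : ℂ) * fourierHat ψ t

/-- `f` has the asymptotic series `∑_{j ≥ 0} a j * φ j` along the filter `l` (in the sense of
Poincaré): each partial sum of the terms before the `N`-th approximates `f` up to `O(φ N)`.
For an asymptotic scale (`φ (N+1) = o(φ N)` for all `N`) this is the same as an error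
`o(φ N)` after the `N`-th term, for every `N`. -/
def HasAsymptoticSeries {E : Type*} (l : Filter E) (f : E → ℝ) (a : ℕ → ℝ) (φ : ℕ → E → ℝ) :
    Prop :=
  ∀ N : ℕ, (fun x => f x - ∑ j ∈ Finset.range N, a j * φ j x) =O[l] φ N

/-- The value of `Γ(a + j) / Γ(a - j)` with removable singularities removed (the two Gamma
functions may both have a pole): the product `(a - j)(a - j + 1) ⋯ (a + j - 1)`, see
`tendsto_Gamma_ratio` and `gammaRatio_eq`. -/
def gammaRatio (a : ℝ) (j : ℕ) : ℝ :=
  ∏ i ∈ Finset.range (2 * j), (a - j + i)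

theorem Gamma_add_natCast_eq_prod (x : ℝ) (k : ℕ) (hx : ∀ i < k, x + i ≠ 0) :
    Real.Gamma (x + k) = (∏ i ∈ Finset.range k, (x + i)) * Real.Gamma x := by
  induction k with
  | zero => simp
  | succ k ih =>
    have h := Real.Gamma_add_one (hx k (Nat.lt_succ_self k))
    rw [Finset.prod_range_succ, Nat.cast_succ, ← add_assoc, h,
      ih fun i hi => hx i (Nat.lt_succ_of_lt hi)]
    ring

/-- Where `Γ(a + j)` has no pole, `gammaRatio` is the quotient of the values of Gamma
(equal to `0` if `Γ(a - j)` has a pole). -/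
theorem gammaRatio_eq (a : ℝ) (j : ℕ) (ha : ∀ m : ℕ, a + j ≠ -m) :
    gammaRatio a j = Real.Gamma (a + j) / Real.Gamma (a - j) := by
  by_cases h : ∃ i < 2 * j, a - j + (i : ℕ) = 0
  · obtain ⟨i, hi, h0⟩ := h
    have hG : Real.Gamma (a - j) = 0 :=
      Real.Gamma_eq_zero_iff _ |>.2 ⟨i, by linarith⟩
    rw [hG, div_zero]
    exact Finset.prod_eq_zero (Finset.mem_range.2 hi) h0
  · push Not at h
    have hG : Real.Gamma (a - j) ≠ 0 := by
      refine Real.Gamma_ne_zero fun m hm => ?_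
      rcases lt_or_ge m (2 * j) with hlt | hge
      · exact h m hlt (by linarith)
      · refine ha (m - 2 * j) ?_
        rw [Nat.cast_sub hge]
        push_cast
        linarith
    have := Gamma_add_natCast_eq_prod (a - j) (2 * j) h
    rw [eq_div_iff hG, gammaRatio, ← this]
    congr 1
    push_cast
    ring

/-- In every case `gammaRatio a j` is the limit of `Γ(x + j) / Γ(x - j)` as `x → a`, `x ≠ a`. -/
theorem tendsto_Gamma_ratio (a : ℝ) (j : ℕ) :
    Tendsto (fun x : ℝ => Real.Gamma (x + j) / Real.Gamma (x - j)) (𝓝[≠] a)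
      (𝓝 (gammaRatio a j)) := by
  have hc : Continuous fun x : ℝ => gammaRatio x j := by
    unfold gammaRatio
    fun_prop
  refine ((hc.tendsto a).mono_left nhdsWithin_le_nhds).congr' ?_
  have hZ : IsClosed (Set.range ((↑) : ℤ → ℝ) \ {a}) := by
    have hs : Set.range ((↑) : ℤ → ℝ) \ {a} = ((↑) : ℤ → ℝ) '' {k | (k : ℝ) ≠ a} := by
      ext x
      constructor
      · rintro ⟨⟨k, rfl⟩, hk⟩
        exact ⟨k, hk, rfl⟩
      · rintro ⟨k, hk, rfl⟩
        exact ⟨⟨k, rfl⟩, hk⟩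
    rw [hs]
    exact Int.isClosedEmbedding_coe_real.isClosedMap _ (isClosed_discrete _)
  have hmem : (Set.range ((↑) : ℤ → ℝ) \ {a})ᶜ ∈ 𝓝 a :=
    hZ.isOpen_compl.mem_nhds fun h => h.2 rfl
  filter_upwards [mem_nhdsWithin_of_mem_nhds hmem, self_mem_nhdsWithin] with x hx hxa
  refine gammaRatio_eq x j fun m hm => hx ⟨⟨-(m : ℤ) - j, ?_⟩, hxa⟩
  push_cast
  linarith

/-- Coefficients of the high-frequency series for `0 < α < 2`. -/
def coeffStable (n : ℕ) (α β : ℝ) (j : ℕ) : ℝ :=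
  1 / Real.pi ^ (((n : ℝ) + 2) / 2) * (1 / Real.Gamma β) *
    ((-1) ^ (j - 1) * 2 ^ (α * j) / (j.factorial : ℝ) * Real.Gamma (β + j) *
      Real.Gamma ((α * j + n) / 2) * Real.Gamma ((α * j + 2) / 2) *
      Real.sin (Real.pi * α * j / 2))

/-- The factor in front of the high-frequency series for `α = 2`, as a function of `r = ‖ω‖`. -/
def prefactorTwo (n : ℕ) (β r : ℝ) : ℝ :=
  r ^ (β - ((n : ℝ) + 1) / 2) /
    (2 ^ (((n : ℝ) - 1) / 2 + β) * Real.pi ^ (((n : ℝ) - 1) / 2) * Real.Gamma β) * Real.exp (-r)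

end

noncomputable section

/-! The covariance is a scale mixture of Gaussians. If `C t = ∫ g(x) exp(-x‖t‖²) dx` over `x > 0`
with `g` integrable and possibly signed, then Fubini shows that the same mixture of heat kernels,
`heatMixture n g`, is a spectral density of `C` (`isSpectralDensity_heatMixture`). Two spectral
densities agree off the origin (`IsSpectralDensity.eq_of_ne_zero`), so it suffices to expand this
one.

For `α < 2` put `a = α/2` and `s = ‖t‖²`. The function `(1 + s^a)^(-β)` is holomorphic in `s` off
the negative axis, and Cauchy's theorem writes it as `∫ ρ(y)/(s + y) dy`, where `ρ`
(`stieltjesDensity`) is its jump across the cut (`integral_stieltjesDensity_div`). Since `1/(s + y)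
= ∫ exp(-x(s + y)) dx`, the weight `g` is the Laplace transform of `ρ`. The binomial series expands
`ρ` in powers `y^(aj)`; the Laplace transform turns these into `x^(-aj-1)`, and the heat kernel
turns those into `‖ω‖^(-αj-n)`. The remainder is bounded by one power on the whole half-line, not
only near an endpoint, so each passage merely integrates an inequality (`abs_integral_sub_sum_le`)
and no domain has to be split. The sine is the imaginary part of `exp(iπaj)`.

For `α = 2` the weight is a Gamma density and the mixture is a Bessel integral of order `1/2 - a`,
now with `a = (n+1)/2 - β`. For `a > 0` it is an explicit Laplace integral
(`besselIntegral_eq_laplace`), to which Watson's lemma applies; for `a ≤ 0` the symmetry `K_ν =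
K_(-ν)` exchanges `a` and `1 - a`, which leaves the coefficients unchanged (`gammaRatio_one_sub`).
-/

theorem exists_one_add_rpow_le_exp (p : ℝ) :
    ∃ K : ℝ, 0 ≤ K ∧ ∀ v : ℝ, 0 ≤ v → (1 + v) ^ p ≤ K * Real.exp v := by
  obtain ⟨m, hm⟩ := exists_nat_ge p
  refine ⟨m.factorial * Real.exp 1, by positivity, fun v hv => ?_⟩
  have h1 : (1 + v) ^ p ≤ (1 + v) ^ m := by
    rw [← Real.rpow_natCast]
    exact Real.rpow_le_rpow_of_exponent_le (by linarith) hm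
  have h2 := Real.pow_div_factorial_le_exp (1 + v) (by linarith) m
  rw [div_le_iff₀ (by positivity), Real.exp_add] at h2
  nlinarith

/-! ### Heat kernels, their mixtures, and uniqueness of the spectral density -/

/-- The heat kernel on `ℝⁿ` at time `x`: the density whose Fourier transform is
`t ↦ exp (-x ‖t‖²)`. -/
def heatKernel (n : ℕ) (x : ℝ) (ω : EuclideanSpace ℝ (Fin n)) : ℝ :=
  (4 * Real.pi * x) ^ (-((n : ℝ) / 2)) * Real.exp (-(‖ω‖ ^ 2 / (4 * x)))

section HeatKernel

variable {n : ℕ}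

theorem heatKernel_nonneg {x : ℝ} (hx : 0 < x) (ω : EuclideanSpace ℝ (Fin n)) :
    0 ≤ heatKernel n x ω := by
  unfold heatKernel
  positivity

theorem measurable_uncurry_heatKernel :
    Measurable (Function.uncurry (heatKernel n)) := by
  unfold heatKernel Function.uncurry
  fun_prop

theorem measurable_heatKernel_left (ω : EuclideanSpace ℝ (Fin n)) :
    Measurable fun x => heatKernel n x ω :=
  measurable_uncurry_heatKernel.comp (measurable_id.prodMk measurable_const)

theorem continuous_heatKernel (x : ℝ) : Continuous (heatKernel n x) := by
  unfold heatKernel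
  fun_prop

theorem heatKernel_eq {x : ℝ} :
    heatKernel n x = fun ω => (4 * Real.pi * x) ^ (-((n : ℝ) / 2)) *
      Real.exp (-(1 / (4 * x)) * ‖ω‖ ^ 2) := by
  ext ω
  unfold heatKernel
  congr 2
  ring

theorem integral_heatKernel {x : ℝ} (hx : 0 < x) :
    ∫ ω, heatKernel n x ω = 1 := by
  rw [heatKernel_eq, integral_const_mul, GaussianFourier.integral_rexp_neg_mul_sq_norm (by positivity),
    finrank_euclideanSpace_fin,
    show Real.pi / (1 / (4 * x)) = 4 * Real.pi * x by field_simp,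
    ← Real.rpow_add (by positivity)]
  simp

theorem integrable_heatKernel {x : ℝ} (hx : 0 < x) : Integrable (heatKernel n x) := by
  -- The integral of a nonintegrable function is `0` by convention, so the value `1` forces
  -- integrability.
  by_contra h
  have := integral_heatKernel (n := n) hx
  rw [integral_undef h] at this
  exact zero_ne_one this

/-- Away from the origin the Gaussian factor beats `x^(-n/2)` as `x → 0`: with `u = δ²/(4x)` the
kernel is at most a constant times `u^(n/2) exp(-u)`. This bound, uniform in `x`, lets merely
integrable weights be mixed. -/
theorem exists_heatKernel_le {δ : ℝ} (hδ : 0 < δ) :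
    ∃ M : ℝ, ∀ x : ℝ, 0 < x → ∀ ω : EuclideanSpace ℝ (Fin n), δ ≤ ‖ω‖ →
      heatKernel n x ω ≤ M := by
  obtain ⟨K, hK, h⟩ := exists_one_add_rpow_le_exp ((n : ℝ) / 2)
  refine ⟨(Real.pi * δ ^ 2) ^ (-((n : ℝ) / 2)) * K, fun x hx ω hω => ?_⟩
  set u := δ ^ 2 / (4 * x) with hu
  have hu0 : 0 < u := by positivity
  have h4 : 4 * Real.pi * x = Real.pi * δ ^ 2 * u⁻¹ := by
    rw [hu]; field_simp
  have hle : Real.exp (-(‖ω‖ ^ 2 / (4 * x))) ≤ Real.exp (-u) := by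
    rw [hu]; gcongr
  unfold heatKernel
  rw [h4, Real.mul_rpow (by positivity) (by positivity), mul_assoc]
  gcongr
  calc u⁻¹ ^ (-((n : ℝ) / 2)) * Real.exp (-(‖ω‖ ^ 2 / (4 * x)))
      ≤ (1 + u) ^ ((n : ℝ) / 2) * Real.exp (-u) := by
        rw [Real.inv_rpow hu0.le, Real.rpow_neg hu0.le, inv_inv]
        gcongr
        linarith
    _ ≤ K * Real.exp u * Real.exp (-u) := by gcongr; exact h u hu0.le
    _ = K := by rw [mul_assoc, ← Real.exp_add]; simp

theorem fourierHat_eq_fourier (ψ : EuclideanSpace ℝ (Fin n) → ℂ) (t : EuclideanSpace ℝ (Fin n)) :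
    fourierHat ψ t = (1 / (2 * (Real.pi : ℂ)) ^ n) *
      FourierTransform.fourier ψ ((2 * Real.pi)⁻¹ • t) := by
  unfold fourierHat
  rw [Real.fourier_eq']
  congr 2
  ext ω
  rw [smul_eq_mul, real_inner_smul_right]
  congr 2
  push_cast
  have : (Real.pi : ℂ) ≠ 0 := by exact_mod_cast Real.pi_ne_zero
  field_simp

theorem integrable_fourierHat (ψ : 𝓢(EuclideanSpace ℝ (Fin n), ℂ)) :
    Integrable (fourierHat (ψ : EuclideanSpace ℝ (Fin n) → ℂ)) := by
  have h := (FourierTransform.fourier ψ).integrable (μ := volume)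
  rw [SchwartzMap.fourier_coe] at h
  have h2 := (h.comp_smul (R := (2 * Real.pi)⁻¹) (by positivity)).const_mul
    (1 / (2 * (Real.pi : ℂ)) ^ n)
  refine h2.congr (.of_forall fun t => ?_)
  rw [fourierHat_eq_fourier]

/-- Fubini moves the Fourier transform from `ψ` to the Gaussian, where it is explicit. The swap is
legitimate because the oscillating factor has modulus one. -/
theorem integral_gaussian_mul_fourierHat {ψ : EuclideanSpace ℝ (Fin n) → ℂ} (hψ : Integrable ψ)
    {x : ℝ} (hx : 0 < x) :
    ∫ t, (Real.exp (-(x * ‖t‖ ^ 2)) : ℂ) * fourierHat ψ t = ∫ ω, (heatKernel n x ω : ℂ) * ψ ω := by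
  have hb : 0 < (x : ℂ).re := by simpa using hx
  have hint : Integrable (fun p : EuclideanSpace ℝ (Fin n) × EuclideanSpace ℝ (Fin n) =>
      Complex.exp (-x * ‖p.1‖ ^ 2 + -Complex.I * ((inner ℝ p.2 p.1 : ℝ) : ℂ)) * ψ p.2)
      (volume.prod volume) := by
    have h1 := GaussianFourier.integrable_cexp_neg_mul_sq_norm_add hb 0
      (0 : EuclideanSpace ℝ (Fin n))
    have h2 := h1.mul_prod hψ
    refine h2.mono ?_ (.of_forall fun p => ?_)
    · refine AEStronglyMeasurable.mul ?_ hψ.aestronglyMeasurable.comp_snd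
      exact Continuous.aestronglyMeasurable (by fun_prop)
    · simp only [norm_mul, Complex.norm_exp]
      refine le_of_eq ?_
      congr 2
      simp
  have key : ∀ t, (Real.exp (-(x * ‖t‖ ^ 2)) : ℂ) * fourierHat ψ t =
      (1 / (2 * (Real.pi : ℂ)) ^ n) *
      ∫ ω, Complex.exp (-x * ‖t‖ ^ 2 + -Complex.I * ((inner ℝ ω t : ℝ) : ℂ)) * ψ ω := by
    intro t
    unfold fourierHat
    rw [mul_left_comm, ← integral_const_mul]
    congr 2
    ext ω
    rw [Complex.exp_add]
    push_cast
    ring_nf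
  simp_rw [key]
  rw [integral_const_mul, integral_integral_swap hint, ← integral_const_mul]
  congr 1
  ext ω
  rw [integral_mul_const, GaussianFourier.integral_cexp_neg_mul_sq_norm_add hb,
    finrank_euclideanSpace_fin, ← mul_assoc, ← mul_assoc]
  congr 1
  have e1 : (Real.pi / x : ℂ) ^ ((n : ℂ) / 2) = (((Real.pi / x) ^ ((n : ℝ) / 2) : ℝ) : ℂ) := by
    rw [Complex.ofReal_cpow (by positivity)]
    push_cast
    rfl
  have e2 : (1 / (2 * (Real.pi : ℂ)) ^ n) = (((2 * Real.pi) ^ (-(n : ℝ)) : ℝ) : ℂ) := by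
    rw [Real.rpow_neg (by positivity), Real.rpow_natCast]
    push_cast
    simp
  have e3 : Complex.exp ((-Complex.I) ^ 2 * ‖ω‖ ^ 2 / (4 * x)) =
      (Real.exp (-(‖ω‖ ^ 2 / (4 * x))) : ℂ) := by
    push_cast
    congr 1
    simp
    ring
  rw [e1, e2, e3, ← Complex.ofReal_mul, ← Complex.ofReal_mul, heatKernel]
  congr 2
  have e4 : (2 * Real.pi) ^ (-(n : ℝ)) = (4 * Real.pi ^ 2) ^ (-((n : ℝ) / 2)) := by
    rw [show (4 * Real.pi ^ 2) = (2 * Real.pi) ^ (2 : ℝ) by norm_num; ring,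
      ← Real.rpow_mul (by positivity)]
    congr 1
    ring
  have e5 : (Real.pi / x) ^ ((n : ℝ) / 2) = (x / Real.pi) ^ (-((n : ℝ) / 2)) := by
    rw [Real.rpow_neg (by positivity), ← Real.inv_rpow (by positivity), inv_div]
  rw [e4, e5, ← Real.mul_rpow (by positivity) (by positivity)]
  congr 1
  field_simp

end HeatKernel

/-- The scale mixture of heat kernels with weight `g`. -/
def heatMixture (n : ℕ) (g : ℝ → ℝ) (ω : EuclideanSpace ℝ (Fin n)) : ℝ :=
  ∫ x in Set.Ioi 0, g x * heatKernel n x ω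

theorem continuousOn_heatMixture {n : ℕ} {g : ℝ → ℝ} (hg : IntegrableOn g (Set.Ioi 0)) :
    ContinuousOn (heatMixture n g) {0}ᶜ := by
  intro ω₀ hω₀
  have h0 : 0 < ‖ω₀‖ := norm_pos_iff.2 hω₀
  obtain ⟨M, hM⟩ := exists_heatKernel_le (n := n) (half_pos h0)
  refine ContinuousAt.continuousWithinAt ?_
  refine continuousAt_of_dominated (bound := fun x => ‖g x‖ * M) ?_ ?_ (hg.norm.mul_const M) ?_
  · exact .of_forall fun ω => hg.aestronglyMeasurable.mul
      (measurable_heatKernel_left ω).aestronglyMeasurable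
  · have : ∀ᶠ ω in 𝓝 ω₀, ‖ω₀‖ / 2 < ‖ω‖ :=
      continuous_norm.continuousAt.eventually (lt_mem_nhds (half_lt_self h0))
    filter_upwards [this] with ω hω
    filter_upwards [ae_restrict_mem measurableSet_Ioi] with x hx
    rw [norm_mul, Real.norm_of_nonneg (heatKernel_nonneg hx ω)]
    gcongr
    exact hM x hx ω hω.le
  · exact .of_forall fun x => ((continuous_heatKernel x).const_mul (g x)).continuousAt

/-- Two applications of Fubini around the Gaussian case. On the frequency side heat kernels have
mass one and `ψ` is bounded; on the other side the Gaussians are at most one and `fourierHat ψ` is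
integrable. Integrability of `g` alone therefore suffices. -/
theorem isSpectralDensity_heatMixture {n : ℕ} {g : ℝ → ℝ} {C : EuclideanSpace ℝ (Fin n) → ℝ}
    (hg : IntegrableOn g (Set.Ioi 0))
    (hC : ∀ᵐ t, C t = ∫ x in Set.Ioi 0, g x * Real.exp (-(x * ‖t‖ ^ 2))) :
    IsSpectralDensity C (heatMixture n g) := by
  have hpos : ∀ᵐ x ∂volume.restrict (Set.Ioi (0 : ℝ)), 0 < x := ae_restrict_mem measurableSet_Ioi
  have hprod : ∀ ψ : 𝓢(EuclideanSpace ℝ (Fin n), ℂ), Integrable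
      (fun p : ℝ × EuclideanSpace ℝ (Fin n) => (g p.1 : ℂ) * ((heatKernel n p.1 p.2 : ℂ) * ψ p.2))
      ((volume.restrict (Set.Ioi 0)).prod volume) := by
    intro ψ
    obtain ⟨M, hM⟩ : ∃ M, ∀ ω, ‖ψ ω‖ ≤ M :=
      ⟨_, fun ω => SchwartzMap.norm_le_seminorm ℝ ψ ω⟩
    have hm : AEStronglyMeasurable
        (fun p : ℝ × EuclideanSpace ℝ (Fin n) => (g p.1 : ℂ) * ((heatKernel n p.1 p.2 : ℂ) * ψ p.2))
        ((volume.restrict (Set.Ioi 0)).prod volume) := by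
      refine AEStronglyMeasurable.mul ?_ (AEStronglyMeasurable.mul ?_ ?_)
      · exact hg.ofReal.aestronglyMeasurable.comp_fst
      · exact (Complex.measurable_ofReal.comp measurable_uncurry_heatKernel).aestronglyMeasurable
      · exact ψ.continuous.aestronglyMeasurable.comp_snd
    have hi : ∀ x : ℝ, 0 < x → Integrable fun ω => (heatKernel n x ω : ℂ) * ψ ω := fun x hx =>
      (integrable_heatKernel hx).ofReal.mul_bdd (c := M)
        ψ.continuous.aestronglyMeasurable (.of_forall hM)
    rw [integrable_prod_iff hm]
    constructor
    · filter_upwards [hpos] with x hx using (hi x hx).const_mul _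
    · refine Integrable.mono' (hg.norm.mul_const M) hm.norm.integral_prod_right' ?_
      filter_upwards [hpos] with x hx
      simp only [norm_mul, integral_const_mul]
      rw [norm_norm, Complex.norm_real, Real.norm_of_nonneg (integral_nonneg fun ω => by positivity)]
      gcongr
      calc ∫ ω, ‖(heatKernel n x ω : ℂ)‖ * ‖ψ ω‖ ≤ ∫ ω, heatKernel n x ω * M := by
            refine integral_mono_of_nonneg (.of_forall fun ω => by positivity)
              ((integrable_heatKernel hx).mul_const M) (.of_forall fun ω => ?_)
            simp only [Complex.norm_real, Real.norm_of_nonneg (heatKernel_nonneg hx ω)]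
            exact mul_le_mul_of_nonneg_left (hM ω) (heatKernel_nonneg hx ω)
        _ = M := by rw [integral_mul_const, integral_heatKernel hx, one_mul]
  have hS : ∀ (ψ : 𝓢(EuclideanSpace ℝ (Fin n), ℂ)) ω, (heatMixture n g ω : ℂ) * ψ ω =
      ∫ x in Set.Ioi 0, (g x : ℂ) * ((heatKernel n x ω : ℂ) * ψ ω) := by
    intro ψ ω
    simp_rw [← mul_assoc]
    rw [integral_mul_const, heatMixture, ← integral_complex_ofReal]
    simp
  refine ⟨continuousOn_heatMixture hg, fun ψ => ?_, fun ψ => ?_⟩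
  · simp_rw [hS]
    exact (hprod ψ).integral_prod_right
  · simp_rw [hS]
    rw [← integral_integral_swap (hprod ψ)]
    have hC' : ∫ t, (C t : ℂ) * fourierHat ψ t = ∫ t, ∫ x in Set.Ioi 0,
        (g x : ℂ) * ((Real.exp (-(x * ‖t‖ ^ 2)) : ℂ) * fourierHat ψ t) := by
      refine integral_congr_ae ?_
      filter_upwards [hC] with t ht
      simp_rw [← mul_assoc]
      rw [integral_mul_const, ht, ← integral_complex_ofReal]
      simp
    have hint : Integrable (fun p : ℝ × EuclideanSpace ℝ (Fin n) =>
        (g p.1 : ℂ) * ((Real.exp (-(p.1 * ‖p.2‖ ^ 2)) : ℂ) * fourierHat ψ p.2))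
        ((volume.restrict (Set.Ioi 0)).prod volume) := by
      have h1 := hg.ofReal (𝕜 := ℂ).mul_prod (integrable_fourierHat ψ)
      refine h1.mono ?_ ?_
      · refine AEStronglyMeasurable.mul ?_ (AEStronglyMeasurable.mul ?_ ?_)
        · exact hg.ofReal.aestronglyMeasurable.comp_fst
        · exact Continuous.aestronglyMeasurable (by fun_prop)
        · exact (integrable_fourierHat ψ).aestronglyMeasurable.comp_snd
      · have : ∀ᵐ p : ℝ × EuclideanSpace ℝ (Fin n)
            ∂(volume.restrict (Set.Ioi (0 : ℝ))).prod volume, 0 < p.1 :=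
          Measure.quasiMeasurePreserving_fst.ae hpos
        filter_upwards [this] with p hp
        simp only [norm_mul]
        refine mul_le_mul_of_nonneg_left (mul_le_of_le_one_left (norm_nonneg _) ?_) (norm_nonneg _)
        rw [Complex.norm_real, Real.norm_of_nonneg (Real.exp_pos _).le]
        exact Real.exp_le_one_iff.2 (neg_nonpos.2 (by positivity))
    rw [hC', ← integral_integral_swap (f := fun x t => (g x : ℂ) *
      ((Real.exp (-(x * ‖t‖ ^ 2)) : ℂ) * fourierHat ψ t)) hint]
    refine setIntegral_congr_fun measurableSet_Ioi fun x hx => ?_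
    simp only [integral_const_mul]
    rw [integral_gaussian_mul_fourierHat ψ.integrable hx]

/-- Test functions supported off the origin give equality almost everywhere there. By continuity a
point of disagreement would have a whole neighbourhood of such points, which has positive measure.
-/
theorem IsSpectralDensity.eq_of_ne_zero {n : ℕ} {C S T : EuclideanSpace ℝ (Fin n) → ℝ}
    (hS : IsSpectralDensity C S) (hT : IsSpectralDensity C T) {ω : EuclideanSpace ℝ (Fin n)}
    (hω : ω ≠ 0) : S ω = T ω := by
  have hc : ContinuousOn (fun ω => S ω - T ω) {0}ᶜ := hS.continuousOn.sub hT.continuousOn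
  have ho : IsOpen ({0}ᶜ : Set (EuclideanSpace ℝ (Fin n))) := isOpen_compl_singleton
  have hae : ∀ᵐ ω, ω ∈ ({0}ᶜ : Set (EuclideanSpace ℝ (Fin n))) → S ω - T ω = 0 := by
    refine ho.ae_eq_zero_of_integral_contDiff_smul_eq_zero
      (hc.locallyIntegrableOn ho.measurableSet) fun φ hφ hφc _ => ?_
    have hφc' : HasCompactSupport fun ω => (φ ω : ℂ) := hφc.comp_left (g := Complex.ofReal) rfl
    have hφ' : ContDiff ℝ (⊤ : ℕ∞) fun ω => (φ ω : ℂ) := Complex.ofRealCLM.contDiff.comp hφ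
    let ψ : 𝓢(EuclideanSpace ℝ (Fin n), ℂ) := hφc'.toSchwartzMap hφ'
    have hψ : ∀ ω, ψ ω = (φ ω : ℂ) := fun ω => rfl
    have h := integral_sub (hS.integrable ψ) (hT.integrable ψ)
    rw [hS.pairing ψ, hT.pairing ψ, sub_self] at h
    have h2 : ((∫ ω, φ ω • (S ω - T ω) : ℝ) : ℂ) = 0 := by
      rw [← h, ← integral_complex_ofReal]
      congr 1
      ext ω
      rw [hψ, smul_eq_mul]
      push_cast
      ring
    exact_mod_cast h2
  by_contra hne
  have hne' : S ω - T ω ≠ 0 := sub_ne_zero.2 hne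
  have hU : {ω | S ω - T ω ≠ 0} ∈ 𝓝 ω := (hc.continuousAt (ho.mem_nhds hω)).eventually_ne hne'
  have hV := inter_mem hU (ho.mem_nhds hω)
  refine (Measure.measure_pos_of_mem_nhds volume hV).ne' (measure_mono_null ?_ hae)
  rintro x ⟨hx1, hx2⟩ hx3
  exact hx1 (hx3 hx2)

/-! ### Binomial expansion with a global remainder -/

/-- The generalized binomial coefficient `p (p - 1) ⋯ (p - j + 1) / j!`. -/
def genBinom (p : ℝ) (j : ℕ) : ℝ :=
  (∏ i ∈ Finset.range j, (p - i)) / (j.factorial : ℝ)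

theorem genBinom_zero (p : ℝ) : genBinom p 0 = 1 := by simp [genBinom]

theorem succ_mul_genBinom_succ (p : ℝ) (j : ℕ) :
    ((j : ℝ) + 1) * genBinom p (j + 1) = p * genBinom (p - 1) j := by
  unfold genBinom
  rw [Finset.prod_range_succ', Nat.factorial_succ]
  have h : ∀ i : ℕ, p - ((i + 1 : ℕ) : ℝ) = p - 1 - i := fun i => by push_cast; ring
  simp_rw [h]
  have : (j.factorial : ℝ) ≠ 0 := by positivity
  push_cast
  field_simp
  ring

/-- Taylor expansion of the binomial series along a ray, with a remainder that is uniform on the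
whole ray. -/
theorem exists_norm_binomial_remainder_le {w : ℂ} {h : ℝ → ℝ}
    (hw : ∀ v : ℝ, 0 ≤ v → 1 + v * w ∈ Complex.slitPlane)
    (hmono : MonotoneOn h (Set.Ici 0)) {p : ℝ}
    (hK : ∀ k : ℕ, ∃ K : ℝ, 0 ≤ K ∧ ∀ v : ℝ, 0 ≤ v →
      ‖(1 + v * w) ^ ((p - k : ℝ) : ℂ)‖ ≤ K * h v) (N : ℕ) :
    ∃ K : ℝ, 0 ≤ K ∧ ∀ v : ℝ, 0 ≤ v →
      ‖(1 + v * w) ^ (p : ℂ) - ∑ j ∈ Finset.range N, (genBinom p j : ℂ) * (v * w) ^ j‖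
        ≤ K * v ^ N * h v := by
  -- Differentiating the remainder of order `N + 1` for `p` gives `p w` times the one of order `N`
  -- for `p - 1`; hence the hypothesis on every `p - k`.
  induction N generalizing p with
  | zero =>
    obtain ⟨K, hK0, h1⟩ := hK 0
    refine ⟨K, hK0, fun v hv => ?_⟩
    simpa using h1 v hv
  | succ N ih =>
    obtain ⟨K, hK0, h1⟩ := ih (p := p - 1) fun k => by
      obtain ⟨K, hK0, h1⟩ := hK (k + 1)
      refine ⟨K, hK0, fun v hv => ?_⟩
      have := h1 v hv
      rwa [show p - ((k + 1 : ℕ) : ℝ) = p - 1 - k by push_cast; ring] at this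
    refine ⟨|p| * ‖w‖ * K, by positivity, fun v hv => ?_⟩
    set R : ℝ → ℂ := fun u => (1 + u * w) ^ (p : ℂ) -
      ∑ j ∈ Finset.range (N + 1), (genBinom p j : ℂ) * (u * w) ^ j with hR
    set R' : ℝ → ℂ := fun u => (p * w) * ((1 + u * w) ^ ((p - 1 : ℝ) : ℂ) -
      ∑ j ∈ Finset.range N, (genBinom (p - 1) j : ℂ) * (u * w) ^ j) with hR'
    have hderiv : ∀ u : ℝ, 0 ≤ u → HasDerivAt R (R' u) u := by
      intro u hu
      have hl : HasDerivAt (fun u : ℂ => u * w) w u := by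
        simpa using (hasDerivAt_id (u : ℂ)).mul_const w
      have hc := (hl.const_add 1).cpow_const (c := (p : ℂ)) (hw u hu)
      have hs : HasDerivAt (fun u : ℂ => ∑ j ∈ Finset.range (N + 1),
          (genBinom p j : ℂ) * (u * w) ^ j)
          (∑ j ∈ Finset.range (N + 1), (genBinom p j : ℂ) * (j * (u * w) ^ (j - 1) * w)) u :=
        HasDerivAt.fun_sum fun j _ => (hl.pow j).const_mul _
      refine (hc.sub hs).comp_ofReal.congr_deriv ?_
      rw [hR', Finset.sum_range_succ']
      simp only [Nat.cast_zero, zero_mul, mul_zero, add_zero, Nat.add_sub_cancel]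
      rw [mul_sub, Finset.mul_sum]
      congr 1
      · push_cast
        ring
      · refine Finset.sum_congr rfl fun j _ => ?_
        have := congrArg (Complex.ofReal) (succ_mul_genBinom_succ p j)
        push_cast at this ⊢
        linear_combination (u * w) ^ j * w * this
    have hb : ∀ u ∈ Set.Icc 0 v, ‖R' u‖ ≤ |p| * ‖w‖ * K * v ^ N * h v := by
      rintro u ⟨hu0, huv⟩
      have h2 := h1 u hu0
      have h3 : K * u ^ N * h u ≤ K * v ^ N * h v := by
        -- The weight `h` may be negative; there the bound itself forces its right-hand side to
        -- vanish.
        rcases le_or_gt 0 (h u) with hn | hn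
        · have := hmono (Set.mem_Ici.2 hu0) (Set.mem_Ici.2 hv) huv
          gcongr
        · have hz : K * u ^ N * h u = 0 :=
            le_antisymm (mul_nonpos_of_nonneg_of_nonpos (by positivity) hn.le)
              ((norm_nonneg _).trans h2)
          rw [hz]
          exact (norm_nonneg _).trans (h1 v hv)
      rw [hR']
      simp only [norm_mul, Complex.norm_real, Real.norm_eq_abs]
      calc |p| * ‖w‖ * _ ≤ |p| * ‖w‖ * (K * v ^ N * h v) := by gcongr; exact h2.trans h3
        _ = _ := by ring
    have h0 : R 0 = 0 := by
      simp [hR, Finset.sum_range_succ', genBinom_zero]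
    have := (convex_Icc (0 : ℝ) v).norm_image_sub_le_of_norm_hasDerivWithin_le (𝕜 := ℝ)
      (fun u hu => (hderiv u hu.1).hasDerivWithinAt) hb
      (Set.left_mem_Icc.2 hv) (Set.right_mem_Icc.2 hv)
    rw [h0, sub_zero, sub_zero, Real.norm_of_nonneg hv] at this
    refine this.trans (le_of_eq ?_)
    ring

/-- The real binomial remainder with an exponential weight. -/
theorem exists_abs_binomial_remainder_le (p : ℝ) (N : ℕ) :
    ∃ K : ℝ, 0 ≤ K ∧ ∀ v : ℝ, 0 ≤ v →
      |(1 + v) ^ p - ∑ j ∈ Finset.range N, genBinom p j * v ^ j| ≤ K * v ^ N * Real.exp v := by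
  have hcast : ∀ (q v : ℝ), 0 ≤ v → (1 + v * 1 : ℂ) ^ (q : ℂ) = (((1 + v) ^ q : ℝ) : ℂ) := by
    intro q v hv
    rw [Complex.ofReal_cpow (by linarith)]
    push_cast
    rw [mul_one]
  obtain ⟨K, hK, h⟩ := exists_norm_binomial_remainder_le (w := 1) (h := Real.exp) (p := p)
    (fun v hv => by
      rw [mul_one, show (1 + v : ℂ) = ((1 + v : ℝ) : ℂ) by push_cast; rfl]
      exact Complex.ofReal_mem_slitPlane.2 (by linarith))
    (Real.exp_monotone.monotoneOn _)
    (fun k => by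
      obtain ⟨K, hK, h⟩ := exists_one_add_rpow_le_exp (p - k)
      refine ⟨K, hK, fun v hv => ?_⟩
      rw [hcast _ _ hv, Complex.norm_real, Real.norm_of_nonneg (by positivity)]
      exact h v hv) N
  refine ⟨K, hK, fun v hv => ?_⟩
  have := h v hv
  rw [hcast _ _ hv] at this
  rw [← Real.norm_eq_abs, ← Complex.norm_real]
  push_cast
  simpa using this

/-! ### Cauchy's theorem in the logarithmic variable -/

theorem one_add_mul_exp_mem_slitPlane {v θ : ℝ} (hv : 0 ≤ v) (hθ : |θ| < Real.pi) :
    1 + (v : ℂ) * Complex.exp (θ * Complex.I) ∈ Complex.slitPlane := by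
  rw [Complex.mem_slitPlane_iff]
  have him : (1 + (v : ℂ) * Complex.exp (θ * Complex.I)).im = v * Real.sin θ := by
    simp [Complex.exp_ofReal_mul_I_im]
  have hre : (1 + (v : ℂ) * Complex.exp (θ * Complex.I)).re = 1 + v * Real.cos θ := by
    simp [Complex.exp_ofReal_mul_I_re]
  rw [him, hre]
  by_cases h : v * Real.sin θ = 0
  · left
    rcases mul_eq_zero.1 h with h | h
    · simp [h]
    · have hθ' := abs_lt.1 hθ
      rw [(Real.sin_eq_zero_iff_of_lt_of_lt hθ'.1 hθ'.2).1 h]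
      simp
      linarith
  · exact Or.inr h

/-- With `c = cos φ`, the identity `1 + 2vc + v² - (1 + c)/2 * (1 + v)² = (1 - c)/2 * (1 - v)²`
shows that `κ² = (1 + c)/2` works; it is positive because `φ < π`. -/
theorem exists_mul_le_norm_one_add_mul_exp {φ : ℝ} (hφ0 : 0 ≤ φ) (hφ : φ < Real.pi) :
    ∃ κ : ℝ, 0 < κ ∧ ∀ v θ : ℝ, 0 ≤ v → |θ| ≤ φ →
      κ * (1 + v) ≤ ‖1 + (v : ℂ) * Complex.exp (θ * Complex.I)‖ := by
  have hc : -1 < Real.cos φ := by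
    rw [← Real.cos_pi]
    exact Real.cos_lt_cos_of_nonneg_of_le_pi hφ0 le_rfl hφ
  refine ⟨√((1 + Real.cos φ) / 2), Real.sqrt_pos.2 (by linarith), fun v θ hv hθ => ?_⟩
  have hcos : Real.cos φ ≤ Real.cos θ := by
    rw [← Real.cos_abs θ]
    exact Real.cos_le_cos_of_nonneg_of_le_pi (abs_nonneg _) hφ.le hθ
  refine le_of_sq_le_sq ?_ (norm_nonneg _)
  rw [mul_pow, Real.sq_sqrt (by linarith), Complex.sq_norm, Complex.normSq_apply]
  have him : (1 + (v : ℂ) * Complex.exp (θ * Complex.I)).im = v * Real.sin θ := by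
    simp [Complex.exp_ofReal_mul_I_im]
  have hre : (1 + (v : ℂ) * Complex.exp (θ * Complex.I)).re = 1 + v * Real.cos θ := by
    simp [Complex.exp_ofReal_mul_I_re]
  rw [him, hre]
  have h1 : Real.cos φ ≤ 1 := Real.cos_le_one φ
  nlinarith [Real.sin_sq_add_cos_sq θ, mul_nonneg (sub_nonneg.2 h1) (sq_nonneg (1 - v)),
    mul_nonneg hv (sub_nonneg.2 hcos)]

/-- The function `z ↦ (1 + z ^ a) ^ (-β)` in the variable `ζ = log z`. -/
def logCauchy (a β : ℝ) (ζ : ℂ) : ℂ :=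
  (1 + Complex.exp (a * ζ)) ^ ((-β : ℝ) : ℂ)

/-- The density of `s ↦ (1 + s ^ a) ^ (-β)` as a (signed) Stieltjes transform. -/
def stieltjesDensity (a β y : ℝ) : ℝ :=
  -(1 / Real.pi) *
    ((1 + ((y ^ a : ℝ) : ℂ) * Complex.exp ((Real.pi * a : ℝ) * Complex.I)) ^ ((-β : ℝ) : ℂ)).im

section Stieltjes

variable {a β : ℝ}

theorem exp_mul_eq (a : ℝ) (ζ : ℂ) : Complex.exp (a * ζ) =
    ((Real.exp (a * ζ.re) : ℝ) : ℂ) * Complex.exp ((a * ζ.im : ℝ) * Complex.I) := by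
  rw [Complex.ofReal_exp, ← Complex.exp_add]
  congr 1
  conv_lhs => rw [← Complex.re_add_im ζ]
  push_cast
  ring

theorem one_add_exp_mem_slitPlane {ζ : ℂ} (h : |a * ζ.im| < Real.pi) :
    1 + Complex.exp (a * ζ) ∈ Complex.slitPlane := by
  rw [exp_mul_eq]
  exact one_add_mul_exp_mem_slitPlane (Real.exp_pos _).le h

theorem differentiableAt_logCauchy {ζ : ℂ} (h : |a * ζ.im| < Real.pi) :
    DifferentiableAt ℂ (logCauchy a β) ζ := by
  unfold logCauchy
  exact DifferentiableAt.cpow_const (by fun_prop) (one_add_exp_mem_slitPlane h)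

theorem logCauchy_conj {ζ : ℂ} (h : |a * ζ.im| < Real.pi) :
    logCauchy a β (starRingEnd ℂ ζ) = starRingEnd ℂ (logCauchy a β ζ) := by
  unfold logCauchy
  have := Complex.conj_cpow _ ((-β : ℝ) : ℂ)
    (Complex.slitPlane_arg_ne_pi (one_add_exp_mem_slitPlane h))
  rw [Complex.conj_ofReal] at this
  rw [← this]
  simp [← Complex.exp_conj]

theorem logCauchy_log {s : ℝ} (hs : 0 < s) :
    logCauchy a β (Real.log s : ℂ) = (((1 + s ^ a) ^ (-β) : ℝ) : ℂ) := by
  unfold logCauchy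
  rw [Complex.ofReal_cpow (by positivity), Real.rpow_def_of_pos hs]
  push_cast
  rw [mul_comm]

/-- In the variable `ζ = log z` the cut plane with both sides of its cut is the closed strip `|Im ζ|
≤ π`. As `a < 1`, `exp(aζ)` stays in a sector that avoids the negative axis, so the bound reaches
the edges and no boundary limits are needed. -/
theorem exists_norm_logCauchy_le (ha : 0 ≤ a) (ha1 : a < 1) (hβ : 0 < β) :
    ∃ K : ℝ, 0 < K ∧ ∀ ζ : ℂ, |ζ.im| ≤ Real.pi →
      ‖logCauchy a β ζ‖ ≤ K * (1 + Real.exp (a * ζ.re)) ^ (-β) := by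
  obtain ⟨κ, hκ, h⟩ := exists_mul_le_norm_one_add_mul_exp (φ := a * Real.pi) (by positivity)
    (by nlinarith [Real.pi_pos])
  refine ⟨κ ^ (-β), by positivity, fun ζ hζ => ?_⟩
  have h1 := h (Real.exp (a * ζ.re)) (a * ζ.im) (Real.exp_pos _).le (by
    rw [abs_mul, abs_of_nonneg ha]; gcongr)
  rw [← exp_mul_eq] at h1
  unfold logCauchy
  rw [Complex.norm_cpow_real, ← Real.mul_rpow hκ.le (by positivity)]
  exact Real.rpow_le_rpow_of_nonpos (by positivity) h1 (by linarith)

theorem stieltjesDensity_exp (x : ℝ) :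
    stieltjesDensity a β (Real.exp x) = -(1 / Real.pi) * (logCauchy a β (x + Real.pi * Complex.I)).im := by
  unfold stieltjesDensity logCauchy
  rw [← Real.exp_mul, Complex.ofReal_exp, ← Complex.exp_add]
  congr 6
  push_cast
  ring

theorem tendsto_logCauchy_right (ha : 0 < a) (ha1 : a < 1) (hβ : 0 < β) {y : ℝ}
    (hy : |y| ≤ Real.pi) :
    Tendsto (fun R : ℝ => logCauchy a β (R + y * Complex.I)) atTop (𝓝 0) := by
  obtain ⟨K, hK, h⟩ := exists_norm_logCauchy_le ha.le ha1 hβ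
  have h1 : Tendsto (fun R : ℝ => K * (1 + Real.exp (a * R)) ^ (-β)) atTop (𝓝 (K * 0)) := by
    refine ((tendsto_rpow_neg_atTop hβ).comp ?_).const_mul K
    exact tendsto_atTop_add_const_left _ _
      (Real.tendsto_exp_atTop.comp (tendsto_id.const_mul_atTop ha))
  rw [mul_zero] at h1
  refine squeeze_zero_norm (fun R => ?_) h1
  simpa using h (R + y * Complex.I) (by simpa using hy)

theorem tendsto_exp_left (c : ℝ) (hc : 0 < c) (y : ℝ) :
    Tendsto (fun R : ℝ => Complex.exp (c * (((-R : ℝ) : ℂ) + y * Complex.I))) atTop (𝓝 0) := by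
  refine tendsto_zero_iff_norm_tendsto_zero.2 ?_
  have : ∀ R : ℝ, ‖Complex.exp (c * (((-R : ℝ) : ℂ) + y * Complex.I))‖ = Real.exp (-(c * R)) := by
    intro R
    rw [Complex.norm_exp]
    simp
  simp_rw [this]
  exact Real.tendsto_exp_neg_atTop_nhds_zero.comp (tendsto_id.const_mul_atTop hc)

theorem tendsto_logCauchy_left (ha : 0 < a) (y : ℝ) :
    Tendsto (fun R : ℝ => logCauchy a β (((-R : ℝ) : ℂ) + y * Complex.I)) atTop (𝓝 1) := by
  have h := ((tendsto_exp_left a ha y).const_add 1)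
  have hc : ContinuousAt (fun z : ℂ => z ^ ((-β : ℝ) : ℂ)) (1 + 0) :=
    continuousAt_cpow_const (by simp)
  have := hc.tendsto.comp h
  simpa [logCauchy, Function.comp_def] using this

/-- The integrand of the contour integral: away from its removable singularity at `log s`, it is
`(F ζ - F (log s)) e^ζ / (e^ζ - s)` for `F = logCauchy a β`. -/
def contourIntegrand (a β s : ℝ) (ζ : ℂ) : ℂ :=
  dslope (logCauchy a β) (Real.log s) ζ * Complex.exp ζ / dslope Complex.exp (Real.log s) ζ

theorem contourIntegrand_eq {s : ℝ} (hs : 0 < s) {ζ : ℂ} (hζ : ζ ≠ Real.log s) :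
    contourIntegrand a β s ζ =
      (logCauchy a β ζ - (((1 + s ^ a) ^ (-β) : ℝ) : ℂ)) *
        (Complex.exp ζ / (Complex.exp ζ - s)) := by
  unfold contourIntegrand
  rw [dslope_of_ne _ hζ, dslope_of_ne _ hζ, slope_def_field, slope_def_field, logCauchy_log hs,
    ← Complex.ofReal_exp, Real.exp_log hs]
  have : ζ - Real.log s ≠ 0 := sub_ne_zero.2 hζ
  rcases eq_or_ne (Complex.exp ζ - s) 0 with h | h
  -- At the other solutions of `exp ζ = s`, outside the strip, both sides are divisions by zero and
  -- equal `0`.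
  · simp [h]
  · field_simp

/-- Solutions of `exp ζ = exp (log s)` are spaced by `2πi`, so here only `log s` itself remains, and
there the derivative is nonzero. The denominator of `contourIntegrand` thus never vanishes on the
strip. -/
theorem dslope_exp_ne_zero {s : ℝ} {ζ : ℂ} (hζ : |ζ.im| < 2 * Real.pi) :
    dslope Complex.exp (Real.log s) ζ ≠ 0 := by
  rcases eq_or_ne ζ (Real.log s) with h | h
  · rw [h, dslope_same, Complex.deriv_exp]
    exact Complex.exp_ne_zero _
  · rw [dslope_of_ne _ h, slope_def_field]
    refine div_ne_zero (fun h0 => h ?_) (sub_ne_zero.2 h)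
    obtain ⟨k, hk⟩ := Complex.exp_eq_exp_iff_exists_int.1 (sub_eq_zero.1 h0)
    have him := congrArg Complex.im hk
    simp at him
    rw [him, abs_mul, abs_of_pos Real.two_pi_pos] at hζ
    have hk1 : |(k : ℝ)| < 1 := by
      by_contra hcon
      push Not at hcon
      nlinarith [Real.two_pi_pos]
    have hk0 : k = 0 := by
      have : |k| < 1 := by exact_mod_cast hk1
      exact Int.abs_lt_one_iff.1 this
    rw [hk, hk0]
    simp

theorem differentiableAt_contourIntegrand (ha : 0 < a) (ha1 : a < 1) {s : ℝ}
    {ζ : ℂ} (hζ : |ζ.im| ≤ Real.pi) : DifferentiableAt ℂ (contourIntegrand a β s) ζ := by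
  have hpi := Real.pi_pos
  set U : Set ℂ := {ζ | |a * ζ.im| < Real.pi} with hU
  have hUo : IsOpen U := isOpen_lt (by fun_prop) continuous_const
  have hlog : (Real.log s : ℂ) ∈ U := by simp [hU, hpi]
  have hζU : ζ ∈ U := by
    rw [hU, Set.mem_ofPred_eq, abs_mul, abs_of_pos ha]
    nlinarith [abs_nonneg ζ.im]
  have h1 : DifferentiableOn ℂ (dslope (logCauchy a β) (Real.log s)) U :=
    (Complex.differentiableOn_dslope (hUo.mem_nhds hlog)).2 fun z hz =>
      (differentiableAt_logCauchy hz).differentiableWithinAt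
  have h2 : DifferentiableOn ℂ (dslope Complex.exp (Real.log s)) Set.univ :=
    (Complex.differentiableOn_dslope univ_mem).2 Complex.differentiable_exp.differentiableOn
  unfold contourIntegrand
  refine DifferentiableAt.div ?_ ?_ (dslope_exp_ne_zero (by linarith))
  · exact ((h1 ζ hζU).differentiableAt (hUo.mem_nhds hζU)).mul Complex.differentiableAt_exp
  · exact (h2 ζ trivial).differentiableAt univ_mem

/-- Cauchy's theorem on the rectangle `[-R, R] × [-π, π]`. On both horizontal edges `exp ζ = -exp
x`, so the subtracted constant cancels between them, and by reflection the difference of conjugate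
values leaves the imaginary part that defines the density. -/
theorem integral_contourIntegrand (ha : 0 < a) (ha1 : a < 1) {s : ℝ} (hs : 0 < s) (R : ℝ) :
    (2 * Real.pi : ℂ) * ((∫ x in (-R)..R, stieltjesDensity a β (Real.exp x) *
        (Real.exp x / (s + Real.exp x)) : ℝ) : ℂ) =
      (∫ y in (-Real.pi)..Real.pi, contourIntegrand a β s (((-R : ℝ) : ℂ) + y * Complex.I)) -
      ∫ y in (-Real.pi)..Real.pi, contourIntegrand a β s (R + y * Complex.I) := by
  have hpi := Real.pi_pos
  have hrect := Complex.integral_boundary_rect_eq_zero_of_differentiableOn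
    (contourIntegrand a β s) (⟨-R, -Real.pi⟩ : ℂ) (⟨R, Real.pi⟩ : ℂ) (by
      rintro ζ ⟨-, hζ⟩
      refine (differentiableAt_contourIntegrand ha ha1 ?_).differentiableWithinAt
      have hζ' : ζ.im ∈ Set.uIcc (-Real.pi) Real.pi := hζ
      rw [Set.uIcc_of_le (by linarith)] at hζ'
      exact abs_le.2 hζ')
  simp only at hrect
  have hline : ∀ c : ℝ, |c| = Real.pi → Continuous fun x : ℝ =>
      contourIntegrand a β s (x + c * Complex.I) := by
    intro c hc
    rw [continuous_iff_continuousAt]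
    intro x
    refine ContinuousAt.comp (f := fun x : ℝ => (x : ℂ) + c * Complex.I)
      (differentiableAt_contourIntegrand ha ha1 ?_).continuousAt (by fun_prop)
    simp [hc]
  rw [← intervalIntegral.integral_sub
    ((hline _ (by rw [abs_neg, abs_of_pos hpi])).intervalIntegrable _ _)
    ((hline _ (abs_of_pos hpi)).intervalIntegrable _ _)] at hrect
  have hdiff : ∀ x : ℝ, contourIntegrand a β s (x + ((-Real.pi : ℝ) : ℂ) * Complex.I) -
      contourIntegrand a β s (x + (Real.pi : ℂ) * Complex.I) =
      (2 * Real.pi * Complex.I : ℂ) * ((stieltjesDensity a β (Real.exp x) *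
        (Real.exp x / (s + Real.exp x)) : ℝ) : ℂ) := by
    intro x
    have hne : ∀ c : ℝ, |c| = Real.pi → (x + c * Complex.I : ℂ) ≠ Real.log s := by
      intro c hc h
      have := congrArg Complex.im h
      simp at this
      rw [this, abs_zero] at hc
      linarith
    have hexp1 : Complex.exp (x + Real.pi * Complex.I) = -(Real.exp x : ℂ) := by
      rw [Complex.exp_add, Complex.exp_pi_mul_I]
      simp
    have hexp2 : Complex.exp (x + ((-Real.pi : ℝ) : ℂ) * Complex.I) = -(Real.exp x : ℂ) := by
      rw [Complex.exp_add]
      push_cast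
      rw [neg_mul, Complex.exp_neg, Complex.exp_pi_mul_I]
      simp
    rw [contourIntegrand_eq hs (hne _ (by rw [abs_neg, abs_of_pos hpi])),
      contourIntegrand_eq hs (hne _ (abs_of_pos hpi)), hexp1, hexp2]
    have hconj : (x + ((-Real.pi : ℝ) : ℂ) * Complex.I : ℂ) =
        starRingEnd ℂ (x + Real.pi * Complex.I) := by
      simp
    have hsx : (s + Real.exp x : ℂ) ≠ 0 := by
      exact_mod_cast (by positivity : s + Real.exp x ≠ 0)
    have hsx' : (-(Real.exp x) - s : ℂ) ≠ 0 := by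
      rw [← neg_ne_zero]
      convert hsx using 1
      ring
    have hpi' : (Real.pi : ℂ) ≠ 0 := by exact_mod_cast hpi.ne'
    rw [hconj, logCauchy_conj (by
      simp [abs_mul, abs_of_pos ha, abs_of_pos hpi]
      nlinarith), ← sub_mul, sub_sub_sub_cancel_right, stieltjesDensity_exp]
    have him := Complex.sub_conj (logCauchy a β (x + Real.pi * Complex.I))
    rw [← neg_sub (logCauchy a β (x + Real.pi * Complex.I)), him]
    push_cast at hsx hsx' ⊢
    field_simp
    ring
  rw [intervalIntegral.integral_congr (g := fun x => (2 * Real.pi * Complex.I : ℂ) *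
      ((stieltjesDensity a β (Real.exp x) * (Real.exp x / (s + Real.exp x)) : ℝ) : ℂ))
      (fun x _ => hdiff x), intervalIntegral.integral_const_mul, intervalIntegral.integral_ofReal]
    at hrect
  rw [smul_eq_mul, smul_eq_mul] at hrect
  have hI := Complex.I_ne_zero
  apply mul_left_cancel₀ hI
  linear_combination hrect

end Stieltjes

/-! ### Gamma integrals and integration of remainders -/

theorem integrableOn_rpow_mul_exp_neg_mul {p r : ℝ} (hp : 0 < p) (hr : 0 < r) :
    IntegrableOn (fun t : ℝ => t ^ (p - 1) * Real.exp (-(r * t))) (Set.Ioi 0) := by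
  have := integrableOn_rpow_mul_exp_neg_mul_rpow (p := 1) (s := p - 1) (b := r)
    (by linarith) one_pos hr
  simpa using this

theorem rpow_inv_comp_eq {p c x : ℝ} (hx : 0 < x) :
    (|(-1 : ℝ)| * x ^ ((-1 : ℝ) - 1)) • ((x ^ (-1 : ℝ)) ^ (p - 1) * Real.exp (-(c * x ^ (-1 : ℝ)))) =
      x ^ (-p - 1) * Real.exp (-(c / x)) := by
  rw [abs_neg, abs_one, one_mul, smul_eq_mul, ← mul_assoc, ← Real.rpow_mul hx.le,
    ← Real.rpow_add hx, Real.rpow_neg_one, div_eq_mul_inv]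
  congr 2
  ring

theorem integrableOn_rpow_mul_exp_neg_div {p c : ℝ} (hp : 0 < p) (hc : 0 < c) :
    IntegrableOn (fun x : ℝ => x ^ (-p - 1) * Real.exp (-(c / x))) (Set.Ioi 0) := by
  refine ((integrableOn_Ioi_comp_rpow_iff _ (neg_ne_zero.2 one_ne_zero)).2
    (integrableOn_rpow_mul_exp_neg_mul hp hc)).congr_fun (fun x hx => ?_) measurableSet_Ioi
  exact rpow_inv_comp_eq (Set.mem_Ioi.1 hx)

theorem integral_rpow_mul_exp_neg_div {p c : ℝ} (hp : 0 < p) (hc : 0 < c) :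
    ∫ x in Set.Ioi 0, x ^ (-p - 1) * Real.exp (-(c / x)) = (1 / c) ^ p * Real.Gamma p := by
  rw [← Real.integral_rpow_mul_exp_neg_mul_Ioi hp hc]
  refine Eq.trans ?_ (integral_comp_rpow_Ioi _ (neg_ne_zero.2 one_ne_zero))
  exact (setIntegral_congr_fun measurableSet_Ioi fun x hx =>
    rpow_inv_comp_eq (Set.mem_Ioi.1 hx)).symm

/-- Carries a pointwise expansion through an integral. It serves the Laplace transform, the heat
mixture and the Bessel integral; `ψ` is separate from `φ N` because the Bessel remainder decays at a
slower exponential rate. -/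
theorem abs_integral_sub_sum_le {X : Type*} [MeasurableSpace X] {μ : Measure X} {f ψ : X → ℝ}
    {c : ℕ → ℝ} {φ : ℕ → X → ℝ} {N : ℕ} {K : ℝ} (hf : Integrable f μ)
    (hφ : ∀ j, Integrable (φ j) μ) (hψ : Integrable ψ μ)
    (h : ∀ᵐ x ∂μ, |f x - ∑ j ∈ Finset.range N, c j * φ j x| ≤ K * ψ x) :
    |∫ x, f x ∂μ - ∑ j ∈ Finset.range N, c j * ∫ x, φ j x ∂μ| ≤ K * ∫ x, ψ x ∂μ := by
  have hs : Integrable (fun x => ∑ j ∈ Finset.range N, c j * φ j x) μ :=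
    integrable_finsetSum _ fun j _ => (hφ j).const_mul _
  have h1 : ∫ x, f x ∂μ - ∑ j ∈ Finset.range N, c j * ∫ x, φ j x ∂μ =
      ∫ x, (f x - ∑ j ∈ Finset.range N, c j * φ j x) ∂μ := by
    rw [integral_sub hf hs, integral_finsetSum _ fun j _ => (hφ j).const_mul _]
    simp_rw [integral_const_mul]
  rw [h1, ← integral_const_mul]
  rw [← Real.norm_eq_abs]
  exact norm_integral_le_of_norm_le (hψ.const_mul K) h

/-! ### The Stieltjes density: size, expansion and transform -/

section Stieltjes

variable {a β : ℝ}

theorem exists_norm_ray_cpow_le (ha : 0 < a) (ha1 : a < 1) :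
    ∃ κ : ℝ, 0 < κ ∧ ∀ q v : ℝ, 0 ≤ q → 0 ≤ v →
      ‖(1 + (v : ℂ) * Complex.exp ((Real.pi * a : ℝ) * Complex.I)) ^ ((-q : ℝ) : ℂ)‖ ≤
        κ ^ (-q) * (1 + v) ^ (-q) := by
  have hpi := Real.pi_pos
  obtain ⟨κ, hκ, h⟩ := exists_mul_le_norm_one_add_mul_exp (φ := Real.pi * a) (by positivity)
    (by nlinarith)
  refine ⟨κ, hκ, fun q v hq hv => ?_⟩
  rw [Complex.norm_cpow_real, ← Real.mul_rpow hκ.le (by positivity)]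
  exact Real.rpow_le_rpow_of_nonpos (by positivity)
    (h v _ hv (abs_of_pos (by positivity)).le) (by linarith)

theorem measurable_stieltjesDensity : Measurable (stieltjesDensity a β) := by
  unfold stieltjesDensity
  fun_prop

theorem exists_abs_stieltjesDensity_le (ha : 0 < a) (ha1 : a < 1) (hβ : 0 < β) :
    ∃ ε : ℝ, 0 < ε ∧ ε < 1 ∧ ∃ K : ℝ, 0 ≤ K ∧ ∀ y : ℝ, 0 < y →
      |stieltjesDensity a β y| ≤ K * y ^ (-ε) := by
  obtain ⟨κ, hκ, h⟩ := exists_norm_ray_cpow_le ha ha1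
  -- The natural exponent `a * β` may exceed `1`; capping `β` at `1` keeps `y^(-ε)` integrable at
  -- zero.
  refine ⟨a * min β 1, by positivity, ?_, 1 / Real.pi * κ ^ (-β), by positivity, fun y hy => ?_⟩
  · calc a * min β 1 ≤ a * 1 := by gcongr; exact min_le_right _ _
      _ < 1 := by linarith
  · have hpi := Real.pi_pos
    have hv : 0 < y ^ a := by positivity
    unfold stieltjesDensity
    rw [abs_mul, abs_neg, abs_of_pos (by positivity), mul_assoc]
    gcongr
    refine (Complex.abs_im_le_norm _).trans ((h β _ hβ.le hv.le).trans ?_)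
    gcongr
    calc (1 + y ^ a) ^ (-β) ≤ (1 + y ^ a) ^ (-min β 1) :=
          Real.rpow_le_rpow_of_exponent_le (by linarith) (neg_le_neg (min_le_left _ _))
      _ ≤ (y ^ a) ^ (-min β 1) := Real.rpow_le_rpow_of_nonpos hv (by linarith)
          (neg_nonpos.2 (by positivity))
      _ = _ := by rw [← Real.rpow_mul hy.le]; ring_nf

/-- The Taylor coefficients of `stieltjesDensity a β` in powers of `y ^ a`. -/
def stieltjesCoeff (a β : ℝ) (j : ℕ) : ℝ :=
  -(1 / Real.pi) * (genBinom (-β) j * Real.sin (Real.pi * a * j))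

theorem exists_abs_stieltjesDensity_sub_le (ha : 0 < a) (ha1 : a < 1) (hβ : 0 < β) (N : ℕ) :
    ∃ K : ℝ, 0 ≤ K ∧ ∀ y : ℝ, 0 < y →
      |stieltjesDensity a β y - ∑ j ∈ Finset.range N,
        stieltjesCoeff a β (j + 1) * y ^ (a * ((j + 1 : ℕ) : ℝ))| ≤
        K * y ^ (a * ((N + 1 : ℕ) : ℝ)) := by
  have hpi := Real.pi_pos
  obtain ⟨κ, hκ, h⟩ := exists_norm_ray_cpow_le ha ha1
  -- Negative powers are bounded along the ray, so the weight `1` suffices. The order is `N + 1`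
  -- because the real constant term is counted but contributes nothing to the imaginary part.
  obtain ⟨K, hK, hr⟩ := exists_norm_binomial_remainder_le
    (w := Complex.exp ((Real.pi * a : ℝ) * Complex.I)) (h := fun _ => 1) (p := -β)
    (fun v hv => one_add_mul_exp_mem_slitPlane hv (by
      rw [abs_of_pos (by positivity)]; nlinarith))
    monotoneOn_const
    (fun k => ⟨κ ^ (-(β + k)), by positivity, fun v hv => by
      rw [show -β - k = -(β + k) by ring]
      refine (h (β + k) v (by positivity) hv).trans ?_
      gcongr
      exact Real.rpow_le_one_of_one_le_of_nonpos (by linarith) (neg_nonpos.2 (by positivity))⟩)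
    (N + 1)
  refine ⟨1 / Real.pi * K, by positivity, fun y hy => ?_⟩
  have hv : 0 < y ^ a := by positivity
  have h1 := (Complex.abs_im_le_norm _).trans (hr (y ^ a) hv.le)
  have hpow : ∀ j : ℕ, (y ^ a) ^ j = y ^ (a * j) := fun j => by
    rw [← Real.rpow_natCast, ← Real.rpow_mul hy.le]
  rw [mul_one, hpow] at h1
  have hterm : ∀ j : ℕ, ((genBinom (-β) j : ℂ) * (((y ^ a : ℝ) : ℂ) *
      Complex.exp ((Real.pi * a : ℝ) * Complex.I)) ^ j).im =
      genBinom (-β) j * Real.sin (Real.pi * a * j) * y ^ (a * j) := by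
    intro j
    rw [mul_pow, ← Complex.exp_nat_mul, ← Complex.ofReal_pow, hpow, ← mul_assoc,
      ← Complex.ofReal_mul, Complex.im_ofReal_mul,
      show (j : ℂ) * (((Real.pi * a : ℝ) : ℂ) * Complex.I) =
        ((Real.pi * a * j : ℝ) : ℂ) * Complex.I by push_cast; ring, Complex.exp_ofReal_mul_I_im]
    ring
  have hid : stieltjesDensity a β y - ∑ j ∈ Finset.range N,
      stieltjesCoeff a β (j + 1) * y ^ (a * ((j + 1 : ℕ) : ℝ)) = -(1 / Real.pi) *
      ((1 + ((y ^ a : ℝ) : ℂ) * Complex.exp ((Real.pi * a : ℝ) * Complex.I)) ^ ((-β : ℝ) : ℂ) -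
        ∑ j ∈ Finset.range (N + 1), (genBinom (-β) j : ℂ) *
          (((y ^ a : ℝ) : ℂ) * Complex.exp ((Real.pi * a : ℝ) * Complex.I)) ^ j).im := by
    rw [Complex.sub_im, Complex.im_sum, Finset.sum_range_succ']
    simp_rw [hterm]
    unfold stieltjesDensity stieltjesCoeff
    simp only [Nat.cast_zero, mul_zero, Real.sin_zero, zero_mul, add_zero]
    rw [mul_sub, Finset.mul_sum]
    congr 1
    refine Finset.sum_congr rfl fun j _ => ?_
    ring
  rw [hid, abs_mul, abs_neg, abs_of_pos (show (0 : ℝ) < 1 / Real.pi by positivity), mul_assoc]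
  exact mul_le_mul_of_nonneg_left h1 (by positivity)

/-- Integrating first in the second variable leaves `Γ(1 - ε) x^(ε-1) exp(-sx)`: the condition `ε <
1` serves the inner integral and `0 < ε` the outer one. -/
theorem integrable_rpow_mul_exp_prod {ε s : ℝ} (hε : 0 < ε) (hε1 : ε < 1) (hs : 0 < s) :
    Integrable (fun p : ℝ × ℝ => p.2 ^ (-ε) * Real.exp (-(p.1 * (s + p.2))))
      ((volume.restrict (Set.Ioi 0)).prod (volume.restrict (Set.Ioi 0))) := by
  have hm : Measurable (fun p : ℝ × ℝ => p.2 ^ (-ε) * Real.exp (-(p.1 * (s + p.2)))) := by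
    fun_prop
  have hfac : ∀ x y : ℝ, y ^ (-ε) * Real.exp (-(x * (s + y))) =
      Real.exp (-(s * x)) * (y ^ (1 - ε - 1) * Real.exp (-(x * y))) := by
    intro x y
    rw [mul_left_comm, ← Real.exp_add]
    ring_nf
  rw [integrable_prod_iff hm.aestronglyMeasurable]
  constructor
  · filter_upwards [ae_restrict_mem measurableSet_Ioi] with x hx
    simp only [hfac]
    exact (integrableOn_rpow_mul_exp_neg_mul (by linarith) hx).const_mul _
  · have h1 : IntegrableOn (fun x => Real.Gamma (1 - ε) * (x ^ (ε - 1) * Real.exp (-(s * x))))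
        (Set.Ioi 0) := (integrableOn_rpow_mul_exp_neg_mul hε hs).const_mul _
    refine h1.congr_fun (fun x hx => ?_) measurableSet_Ioi
    have hx' : 0 < x := hx
    have : ∀ y ∈ Set.Ioi (0 : ℝ), ‖y ^ (-ε) * Real.exp (-(x * (s + y)))‖ =
        Real.exp (-(s * x)) * (y ^ (1 - ε - 1) * Real.exp (-(x * y))) := by
      intro y hy
      have hy' : 0 < y := hy
      rw [Real.norm_of_nonneg (by positivity), hfac]
    simp only
    rw [setIntegral_congr_fun measurableSet_Ioi this, integral_const_mul,
      Real.integral_rpow_mul_exp_neg_mul_Ioi (by linarith) hx', one_div, Real.inv_rpow hx'.le,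
      ← Real.rpow_neg hx'.le, neg_sub]
    ring

theorem integrable_stieltjesDensity_prod (ha : 0 < a) (ha1 : a < 1) (hβ : 0 < β) {s : ℝ}
    (hs : 0 < s) :
    Integrable (fun p : ℝ × ℝ => stieltjesDensity a β p.2 * Real.exp (-(p.1 * (s + p.2))))
      ((volume.restrict (Set.Ioi 0)).prod (volume.restrict (Set.Ioi 0))) := by
  obtain ⟨ε, hε, hε1, K, hK, h⟩ := exists_abs_stieltjesDensity_le ha ha1 hβ
  have hm : Measurable (stieltjesDensity a β) := measurable_stieltjesDensity
  refine ((integrable_rpow_mul_exp_prod hε hε1 hs).const_mul K).mono' ?_ ?_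
  · exact Measurable.aestronglyMeasurable (by fun_prop)
  · have : ∀ᵐ p : ℝ × ℝ ∂(volume.restrict (Set.Ioi (0 : ℝ))).prod
        (volume.restrict (Set.Ioi (0 : ℝ))), 0 < p.2 :=
      Measure.quasiMeasurePreserving_snd.ae (ae_restrict_mem measurableSet_Ioi)
    filter_upwards [this] with p hp
    rw [norm_mul, Real.norm_of_nonneg (Real.exp_pos _).le, ← mul_assoc]
    gcongr
    exact h _ hp

theorem integral_exp_neg_mul_Ioi_eq_inv {r : ℝ} (hr : 0 < r) :
    ∫ x in Set.Ioi 0, Real.exp (-(x * r)) = r⁻¹ := by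
  have := Real.integral_rpow_mul_exp_neg_mul_Ioi (a := 1) one_pos hr
  simpa [mul_comm] using this

theorem integrableOn_stieltjesDensity_div (ha : 0 < a) (ha1 : a < 1) (hβ : 0 < β) {s : ℝ}
    (hs : 0 < s) :
    IntegrableOn (fun y => stieltjesDensity a β y * (s + y)⁻¹) (Set.Ioi 0) := by
  have h := (integrable_stieltjesDensity_prod ha ha1 hβ hs).integral_prod_right
  refine IntegrableOn.congr_fun h (fun y hy => ?_) measurableSet_Ioi
  have hy' : 0 < y := hy
  simp only
  rw [integral_const_mul, integral_exp_neg_mul_Ioi_eq_inv (by positivity)]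

theorem integrable_stieltjesDensity_exp (ha : 0 < a) (ha1 : a < 1) (hβ : 0 < β) {s : ℝ}
    (hs : 0 < s) :
    Integrable (fun x => stieltjesDensity a β (Real.exp x) *
      (Real.exp x / (s + Real.exp x))) ∧
    ∫ x, stieltjesDensity a β (Real.exp x) * (Real.exp x / (s + Real.exp x)) =
      ∫ y in Set.Ioi 0, stieltjesDensity a β y * (s + y)⁻¹ := by
  have himg : Real.exp '' Set.univ = Set.Ioi 0 := by rw [Set.image_univ, Real.range_exp]
  have hd : ∀ x ∈ Set.univ, HasDerivWithinAt Real.exp (Real.exp x) Set.univ x :=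
    fun x _ => (Real.hasDerivAt_exp x).hasDerivWithinAt
  have hint := integrableOn_stieltjesDensity_div ha ha1 hβ hs
  have heq : ∀ x, |Real.exp x| • (stieltjesDensity a β (Real.exp x) * (s + Real.exp x)⁻¹) =
      stieltjesDensity a β (Real.exp x) * (Real.exp x / (s + Real.exp x)) := by
    intro x
    rw [abs_of_pos (Real.exp_pos x), smul_eq_mul, div_eq_mul_inv]
    ring
  constructor
  · rw [← himg, integrableOn_image_iff_integrableOn_abs_deriv_smul MeasurableSet.univ hd
      Real.exp_injective.injOn, integrableOn_univ] at hint
    simpa only [heq] using hint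
  · rw [← himg, integral_image_eq_integral_abs_deriv_smul MeasurableSet.univ hd
      Real.exp_injective.injOn]
    simp only [heq, Measure.restrict_univ]

/-- On the right edge `logCauchy` tends to `0` and `exp ζ / (exp ζ - s)` to `1`, so only the
subtracted constant survives, over an edge of length `2π`. This is where the value of the covariance
comes from. -/
theorem tendsto_integral_contourIntegrand_right (ha : 0 < a) (ha1 : a < 1) (hβ : 0 < β) {s : ℝ}
    (hs : 0 < s) :
    Tendsto (fun R : ℝ => ∫ y in (-Real.pi)..Real.pi,
      contourIntegrand a β s (R + y * Complex.I)) atTop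
      (𝓝 (-(2 * Real.pi * (((1 + s ^ a) ^ (-β) : ℝ) : ℂ)))) := by
  have hpi := Real.pi_pos
  obtain ⟨K, hK, h⟩ := exists_norm_logCauchy_le ha.le ha1 hβ
  have hlim : -(2 * Real.pi * (((1 + s ^ a) ^ (-β) : ℝ) : ℂ)) =
      ∫ y in (-Real.pi)..Real.pi, -(((1 + s ^ a) ^ (-β) : ℝ) : ℂ) := by
    rw [intervalIntegral.integral_const, Complex.real_smul]
    push_cast
    ring
  have heq : ∀ᶠ R : ℝ in atTop, ∀ y : ℝ, contourIntegrand a β s (R + y * Complex.I) =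
      (logCauchy a β (R + y * Complex.I) - (((1 + s ^ a) ^ (-β) : ℝ) : ℂ)) *
        (1 - s * Complex.exp (-(R + y * Complex.I)))⁻¹ := by
    filter_upwards [eventually_gt_atTop (Real.log s)] with R hR y
    rw [contourIntegrand_eq hs]
    · congr 1
      rw [Complex.exp_neg, eq_comm, inv_eq_iff_eq_inv, inv_div, sub_div,
        div_self (Complex.exp_ne_zero _), div_eq_mul_inv]
    · intro h
      have := congrArg Complex.re h
      simp at this
      linarith
  have hexp : Tendsto (fun R : ℝ => s * Real.exp (-R)) atTop (𝓝 (s * 0)) :=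
    Real.tendsto_exp_neg_atTop_nhds_zero.const_mul s
  rw [mul_zero] at hexp
  have hnorm : ∀ R y : ℝ, ‖(s : ℂ) * Complex.exp (-(R + y * Complex.I))‖ = s * Real.exp (-R) := by
    intro R y
    rw [norm_mul, Complex.norm_exp]
    simp [abs_of_pos hs]
  rw [hlim]
  have hcongr : (fun R : ℝ => ∫ y in (-Real.pi)..Real.pi,
      contourIntegrand a β s (R + y * Complex.I)) =ᶠ[atTop] fun R : ℝ =>
      ∫ y in (-Real.pi)..Real.pi,
        (logCauchy a β (R + y * Complex.I) - (((1 + s ^ a) ^ (-β) : ℝ) : ℂ)) *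
        (1 - s * Complex.exp (-(R + y * Complex.I)))⁻¹ :=
    heq.mono fun R hR => intervalIntegral.integral_congr fun y _ => hR y
  rw [tendsto_congr' hcongr]
  refine intervalIntegral.tendsto_integral_filter_of_dominated_convergence
    (fun _ => (K + (1 + s ^ a) ^ (-β)) * 2) ?_ ?_ (by simp) ?_
  · refine .of_forall fun R => Measurable.aestronglyMeasurable ?_
    unfold logCauchy
    fun_prop
  · filter_upwards [hexp.eventually (gt_mem_nhds (show (0 : ℝ) < 1 / 2 by norm_num))] with R hR
    refine .of_forall fun y hy => ?_
    have hy' : |y| ≤ Real.pi := by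
      rw [Set.uIoc_of_le (by linarith)] at hy
      exact abs_le.2 ⟨hy.1.le, hy.2⟩
    rw [norm_mul]
    gcongr
    · refine (norm_sub_le _ _).trans (add_le_add ?_ ?_)
      · refine (h _ (by simpa using hy')).trans (mul_le_of_le_one_right hK.le ?_)
        exact Real.rpow_le_one_of_one_le_of_nonpos (by linarith [Real.exp_pos (a * (R + y * Complex.I : ℂ).re)])
          (by linarith)
      · rw [Complex.norm_real, Real.norm_of_nonneg (by positivity)]
    · rw [norm_inv]
      refine inv_le_of_inv_le₀ two_pos ?_
      have := norm_sub_norm_le (1 : ℂ) (s * Complex.exp (-(R + y * Complex.I)))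
      rw [hnorm, norm_one] at this
      refine le_trans ?_ this
      linarith
  · refine .of_forall fun y hy => ?_
    have hy' : |y| ≤ Real.pi := by
      rw [Set.uIoc_of_le (by linarith)] at hy
      exact abs_le.2 ⟨hy.1.le, hy.2⟩
    have h1 : Tendsto (fun R : ℝ => (s : ℂ) * Complex.exp (-(R + y * Complex.I))) atTop (𝓝 0) := by
      refine tendsto_zero_iff_norm_tendsto_zero.2 ?_
      simpa only [hnorm] using hexp
    have h2 := ((tendsto_logCauchy_right ha ha1 hβ hy').sub_const
      (((1 + s ^ a) ^ (-β) : ℝ) : ℂ)).mul ((h1.const_sub 1).inv₀ (by simp))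
    simpa using h2

/-- Here `logCauchy` stays bounded while `exp ζ / (exp ζ - s)` tends to `0`. -/
theorem tendsto_integral_contourIntegrand_left (ha : 0 < a) (ha1 : a < 1) (hβ : 0 < β) {s : ℝ}
    (hs : 0 < s) :
    Tendsto (fun R : ℝ => ∫ y in (-Real.pi)..Real.pi,
      contourIntegrand a β s (((-R : ℝ) : ℂ) + y * Complex.I)) atTop (𝓝 0) := by
  have hpi := Real.pi_pos
  obtain ⟨K, hK, h⟩ := exists_norm_logCauchy_le ha.le ha1 hβ
  have hlim : (0 : ℂ) = ∫ y in (-Real.pi)..Real.pi, 0 := by simp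
  have heq : ∀ᶠ R : ℝ in atTop, ∀ y : ℝ, contourIntegrand a β s (((-R : ℝ) : ℂ) + y * Complex.I) =
      (logCauchy a β (((-R : ℝ) : ℂ) + y * Complex.I) - (((1 + s ^ a) ^ (-β) : ℝ) : ℂ)) *
        (Complex.exp (((-R : ℝ) : ℂ) + y * Complex.I) /
          (Complex.exp (((-R : ℝ) : ℂ) + y * Complex.I) - s)) := by
    filter_upwards [eventually_gt_atTop (-Real.log s)] with R hR y
    rw [contourIntegrand_eq hs]
    intro h
    have := congrArg Complex.re h
    simp at this
    linarith
  have hexp := Real.tendsto_exp_neg_atTop_nhds_zero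
  have hnorm : ∀ R y : ℝ, ‖Complex.exp (((-R : ℝ) : ℂ) + y * Complex.I)‖ = Real.exp (-R) := by
    intro R y
    rw [Complex.norm_exp]
    simp
  rw [hlim]
  have hcongr : (fun R : ℝ => ∫ y in (-Real.pi)..Real.pi,
      contourIntegrand a β s (((-R : ℝ) : ℂ) + y * Complex.I)) =ᶠ[atTop] fun R : ℝ =>
      ∫ y in (-Real.pi)..Real.pi,
        (logCauchy a β (((-R : ℝ) : ℂ) + y * Complex.I) - (((1 + s ^ a) ^ (-β) : ℝ) : ℂ)) *
        (Complex.exp (((-R : ℝ) : ℂ) + y * Complex.I) /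
          (Complex.exp (((-R : ℝ) : ℂ) + y * Complex.I) - s)) :=
    heq.mono fun R hR => intervalIntegral.integral_congr fun y _ => hR y
  rw [tendsto_congr' hcongr]
  refine intervalIntegral.tendsto_integral_filter_of_dominated_convergence
    (fun _ => (K + (1 + s ^ a) ^ (-β)) * 1) ?_ ?_ (by simp) ?_
  · refine .of_forall fun R => Measurable.aestronglyMeasurable ?_
    unfold logCauchy
    fun_prop
  · filter_upwards [hexp.eventually (gt_mem_nhds (show (0 : ℝ) < s / 2 by positivity))] with R hR
    refine .of_forall fun y hy => ?_
    have hy' : |y| ≤ Real.pi := by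
      rw [Set.uIoc_of_le (by linarith)] at hy
      exact abs_le.2 ⟨hy.1.le, hy.2⟩
    rw [norm_mul]
    gcongr
    · refine (norm_sub_le _ _).trans (add_le_add ?_ ?_)
      · refine (h _ (by simpa using hy')).trans (mul_le_of_le_one_right hK.le ?_)
        exact Real.rpow_le_one_of_one_le_of_nonpos
          (by linarith [Real.exp_pos (a * (((-R : ℝ) : ℂ) + y * Complex.I : ℂ).re)]) (by linarith)
      · rw [Complex.norm_real, Real.norm_of_nonneg (by positivity)]
    · rw [norm_div]
      have := norm_sub_norm_le (s : ℂ) (Complex.exp (((-R : ℝ) : ℂ) + y * Complex.I))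
      rw [norm_sub_rev, hnorm, Complex.norm_real, Real.norm_of_nonneg hs.le] at this
      rw [hnorm, div_le_one (by linarith)]
      linarith
  · refine .of_forall fun y hy => ?_
    have h1 : Tendsto (fun R : ℝ => Complex.exp (((-R : ℝ) : ℂ) + y * Complex.I)) atTop (𝓝 0) := by
      refine tendsto_zero_iff_norm_tendsto_zero.2 ?_
      simpa only [hnorm] using hexp
    have h2 := ((tendsto_logCauchy_left (β := β) ha y).sub_const
      (((1 + s ^ a) ^ (-β) : ℝ) : ℂ)).mul (h1.div (h1.sub_const (s : ℂ)) (by simpa using hs.ne'))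
    simpa using h2

theorem integral_stieltjesDensity_div (ha : 0 < a) (ha1 : a < 1) (hβ : 0 < β) {s : ℝ}
    (hs : 0 < s) :
    ∫ y in Set.Ioi 0, stieltjesDensity a β y * (s + y)⁻¹ = (1 + s ^ a) ^ (-β) := by
  obtain ⟨hint, heq⟩ := integrable_stieltjesDensity_exp ha ha1 hβ hs
  rw [← heq]
  have h1 := (tendsto_integral_contourIntegrand_left ha ha1 hβ hs).sub
    (tendsto_integral_contourIntegrand_right ha ha1 hβ hs)
  simp_rw [← integral_contourIntegrand ha ha1 hs] at h1
  have h2 := (((Complex.continuous_ofReal.tendsto _).comp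
    (intervalIntegral_tendsto_integral hint tendsto_neg_atTop_atBot tendsto_id)).const_mul
      (2 * Real.pi : ℂ))
  have h3 := tendsto_nhds_unique h2 h1
  rw [zero_sub, neg_neg] at h3
  have hpi : (2 * Real.pi : ℂ) ≠ 0 := by
    exact_mod_cast (by positivity : (2 * Real.pi : ℝ) ≠ 0)
  exact_mod_cast mul_left_cancel₀ hpi h3

end Stieltjes

/-! ### The mixing weight as a Laplace transform -/

theorem integral_rpow_mul_exp_neg_mul {p x : ℝ} (hp : 0 < p) (hx : 0 < x) :
    IntegrableOn (fun y : ℝ => y ^ p * Real.exp (-(x * y))) (Set.Ioi 0) ∧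
    ∫ y in Set.Ioi 0, y ^ p * Real.exp (-(x * y)) = Real.Gamma (p + 1) * x ^ (-p - 1) := by
  have h1 := integrableOn_rpow_mul_exp_neg_mul (p := p + 1) (by linarith) hx
  have h2 := Real.integral_rpow_mul_exp_neg_mul_Ioi (a := p + 1) (by linarith) hx
  rw [add_sub_cancel_right] at h1 h2
  refine ⟨h1, h2.trans ?_⟩
  rw [one_div, Real.inv_rpow hx.le, ← Real.rpow_neg hx.le, neg_add', mul_comm]

theorem genBinom_neg {β : ℝ} (hβ : 0 < β) (j : ℕ) :
    genBinom (-β) j = (-1) ^ j * Real.Gamma (β + j) / (Real.Gamma β * j.factorial) := by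
  have h : ∀ i : ℕ, -β - i = -1 * (β + i) := fun i => by ring
  unfold genBinom
  simp_rw [h]
  rw [Gamma_add_natCast_eq_prod β j fun i _ => by positivity, Finset.prod_mul_distrib,
    Finset.prod_const, Finset.card_range]
  have := (Real.Gamma_pos_of_pos hβ).ne'
  field_simp

/-- The Laplace transform of `stieltjesDensity a β`; it is also the inverse Laplace transform of
`s ↦ (1 + s ^ a) ^ (-β)`. -/
def stieltjesLaplace (a β x : ℝ) : ℝ :=
  ∫ y in Set.Ioi 0, stieltjesDensity a β y * Real.exp (-(x * y))

section Stieltjes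

variable {a β : ℝ}

theorem integrableOn_stieltjesDensity_mul_exp (ha : 0 < a) (ha1 : a < 1) (hβ : 0 < β) {x : ℝ}
    (hx : 0 < x) :
    IntegrableOn (fun y => stieltjesDensity a β y * Real.exp (-(x * y))) (Set.Ioi 0) := by
  obtain ⟨ε, hε, hε1, K, hK, h⟩ := exists_abs_stieltjesDensity_le ha ha1 hβ
  have hm : Measurable (stieltjesDensity a β) := measurable_stieltjesDensity
  have hi := (integrableOn_rpow_mul_exp_neg_mul (p := 1 - ε) (by linarith) hx).const_mul K
  refine Integrable.mono' hi (Measurable.aestronglyMeasurable (by fun_prop)) ?_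
  filter_upwards [ae_restrict_mem measurableSet_Ioi] with y hy
  rw [norm_mul, Real.norm_of_nonneg (Real.exp_pos _).le, ← mul_assoc, sub_sub_cancel_left]
  gcongr
  exact h y hy

theorem aestronglyMeasurable_stieltjesLaplace (μ : Measure ℝ) :
    AEStronglyMeasurable (stieltjesLaplace a β) μ := by
  have hm : Measurable (stieltjesDensity a β) := measurable_stieltjesDensity
  have : Measurable (fun p : ℝ × ℝ => stieltjesDensity a β p.2 * Real.exp (-(p.1 * p.2))) := by
    fun_prop
  exact this.stronglyMeasurable.integral_prod_right'.aestronglyMeasurable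

/-- Watson's lemma, but with a bound for every `x > 0`, since the expansion of the density is
global. -/
theorem exists_abs_stieltjesLaplace_sub_le (ha : 0 < a) (ha1 : a < 1) (hβ : 0 < β) (N : ℕ) :
    ∃ K : ℝ, ∀ x : ℝ, 0 < x →
      |stieltjesLaplace a β x - ∑ j ∈ Finset.range N,
        (stieltjesCoeff a β (j + 1) * Real.Gamma (a * ((j + 1 : ℕ) : ℝ) + 1)) *
          x ^ (-(a * ((j + 1 : ℕ) : ℝ)) - 1)| ≤ K * x ^ (-(a * ((N + 1 : ℕ) : ℝ)) - 1) := by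
  obtain ⟨K, hK, h⟩ := exists_abs_stieltjesDensity_sub_le ha ha1 hβ N
  refine ⟨K * Real.Gamma (a * ((N + 1 : ℕ) : ℝ) + 1), fun x hx => ?_⟩
  have hpow : ∀ j : ℕ, _ := fun j : ℕ =>
    integral_rpow_mul_exp_neg_mul (p := a * ((j + 1 : ℕ) : ℝ)) (by positivity) hx
  have hb := abs_integral_sub_sum_le (N := N) (K := K) (c := fun j => stieltjesCoeff a β (j + 1))
    (integrableOn_stieltjesDensity_mul_exp ha ha1 hβ hx)
    (fun j => (hpow j).1) (hpow N).1 (by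
      filter_upwards [ae_restrict_mem measurableSet_Ioi] with y hy
      simp_rw [← mul_assoc]
      rw [← Finset.sum_mul, ← sub_mul, abs_mul, abs_of_pos (Real.exp_pos _)]
      gcongr
      exact h y hy)
  simp_rw [fun j => (hpow j).2, ← mul_assoc] at hb
  exact hb

/-- Near zero the bound `y^(-ε)` on the density gives `x^(ε-1)`; at infinity the expansion with no
terms gives `x^(-a-1)`. -/
theorem integrableOn_stieltjesLaplace (ha : 0 < a) (ha1 : a < 1) (hβ : 0 < β) :
    IntegrableOn (stieltjesLaplace a β) (Set.Ioi 0) := by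
  obtain ⟨ε, hε, hε1, K, hK, h⟩ := exists_abs_stieltjesDensity_le ha ha1 hβ
  obtain ⟨K', h'⟩ := exists_abs_stieltjesLaplace_sub_le ha ha1 hβ 0
  rw [← Set.Ioc_union_Ioi_eq_Ioi zero_le_one, integrableOn_union]
  constructor
  · have hi : IntegrableOn (fun x : ℝ => K * Real.Gamma (1 - ε) * x ^ (ε - 1)) (Set.Ioc 0 1) := by
      rw [← intervalIntegrable_iff_integrableOn_Ioc_of_le zero_le_one]
      exact (intervalIntegral.intervalIntegrable_rpow' (by linarith)).const_mul _
    refine hi.mono' (aestronglyMeasurable_stieltjesLaplace _) ?_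
    filter_upwards [ae_restrict_mem measurableSet_Ioc] with x hx
    have hx0 : 0 < x := hx.1
    calc ‖stieltjesLaplace a β x‖
        ≤ ∫ y in Set.Ioi 0, K * (y ^ (1 - ε - 1) * Real.exp (-(x * y))) := by
          refine norm_integral_le_of_norm_le
            ((integrableOn_rpow_mul_exp_neg_mul (by linarith) hx0).const_mul K) ?_
          filter_upwards [ae_restrict_mem measurableSet_Ioi] with y hy
          rw [norm_mul, Real.norm_of_nonneg (Real.exp_pos _).le, ← mul_assoc, sub_sub_cancel_left]
          gcongr
          exact h y hy
      _ = _ := by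
          rw [integral_const_mul, Real.integral_rpow_mul_exp_neg_mul_Ioi (by linarith) hx0, one_div,
            Real.inv_rpow hx0.le, ← Real.rpow_neg hx0.le, neg_sub]
          ring
  · have hi : IntegrableOn (fun x : ℝ => K' * x ^ (-a - 1)) (Set.Ioi 1) :=
      (integrableOn_Ioi_rpow_of_lt (by linarith) one_pos).const_mul _
    refine hi.mono' (aestronglyMeasurable_stieltjesLaplace _) ?_
    filter_upwards [ae_restrict_mem measurableSet_Ioi] with x hx
    simpa using h' x (one_pos.trans hx)

theorem integral_stieltjesLaplace_mul_exp (ha : 0 < a) (ha1 : a < 1) (hβ : 0 < β) {s : ℝ}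
    (hs : 0 < s) :
    ∫ x in Set.Ioi 0, stieltjesLaplace a β x * Real.exp (-(x * s)) = (1 + s ^ a) ^ (-β) := by
  rw [← integral_stieltjesDensity_div ha ha1 hβ hs]
  have h := integral_integral_swap
    (f := fun x y => stieltjesDensity a β y * Real.exp (-(x * (s + y))))
    (integrable_stieltjesDensity_prod ha ha1 hβ hs)
  refine Eq.trans ?_ (h.trans ?_)
  · refine setIntegral_congr_fun measurableSet_Ioi fun x _ => ?_
    unfold stieltjesLaplace
    rw [← integral_mul_const]
    refine integral_congr_ae (.of_forall fun y => ?_)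
    simp only
    rw [mul_assoc, ← Real.exp_add]
    ring_nf
  · refine setIntegral_congr_fun measurableSet_Ioi fun y hy => ?_
    have hy' : 0 < y := hy
    rw [integral_const_mul, integral_exp_neg_mul_Ioi_eq_inv (by positivity)]

end Stieltjes

/-! ### The expansion for `α < 2` -/

theorem integral_rpow_mul_heatKernel {n : ℕ} {p : ℝ} (hp : 0 < p) {ω : EuclideanSpace ℝ (Fin n)}
    (hω : 0 < ‖ω‖) :
    IntegrableOn (fun x : ℝ => x ^ (-p - 1) * heatKernel n x ω) (Set.Ioi 0) ∧
    ∫ x in Set.Ioi 0, x ^ (-p - 1) * heatKernel n x ω =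
      Real.pi ^ (-((n : ℝ) / 2)) * 4 ^ p * Real.Gamma (p + n / 2) *
        ‖ω‖ ^ (-(2 * p) - (n : ℝ)) := by
  have hq : 0 < p + n / 2 := by positivity
  have hc : 0 < ‖ω‖ ^ 2 / 4 := by positivity
  have heq : ∀ x ∈ Set.Ioi (0 : ℝ), (4 * Real.pi) ^ (-((n : ℝ) / 2)) *
      (x ^ (-(p + n / 2) - 1) * Real.exp (-(‖ω‖ ^ 2 / 4 / x))) =
      x ^ (-p - 1) * heatKernel n x ω := by
    intro x hx
    have hx' : 0 < x := hx
    unfold heatKernel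
    rw [Real.mul_rpow (by positivity) hx'.le, div_div,
      show -(p + (n : ℝ) / 2) - 1 = (-p - 1) + -((n : ℝ) / 2) by ring, Real.rpow_add hx']
    ring
  constructor
  · exact IntegrableOn.congr_fun ((integrableOn_rpow_mul_exp_neg_div hq hc).const_mul _) heq measurableSet_Ioi
  · rw [← setIntegral_congr_fun measurableSet_Ioi heq, integral_const_mul,
      integral_rpow_mul_exp_neg_div hq hc, one_div_div, Real.div_rpow (by norm_num) (by positivity),
      Real.mul_rpow (by norm_num) Real.pi_pos.le, Real.rpow_add (by norm_num : (0 : ℝ) < 4),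
      Real.rpow_neg (by norm_num : (0 : ℝ) ≤ 4), ← Real.rpow_natCast ‖ω‖ 2,
      ← Real.rpow_mul (norm_nonneg _),
      show -(2 * p) - (n : ℝ) = -(((2 : ℕ) : ℝ) * (p + n / 2)) by push_cast; ring,
      Real.rpow_neg (norm_nonneg _)]
    have : (4 : ℝ) ^ ((n : ℝ) / 2) ≠ 0 := by positivity
    field_simp

/-- The factors are the density coefficient, its Laplace moment and the heat-kernel moment. The
minus sign of the density turns `(-1)^(j+1)` into `(-1)^j`. -/
theorem coeffStable_eq {n : ℕ} {α β : ℝ} (hβ : 0 < β) (j : ℕ) :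
    coeffStable n α β (j + 1) =
      (stieltjesCoeff (α / 2) β (j + 1) * Real.Gamma (α / 2 * ((j + 1 : ℕ) : ℝ) + 1)) *
      (Real.pi ^ (-((n : ℝ) / 2)) * 4 ^ (α / 2 * ((j + 1 : ℕ) : ℝ)) *
        Real.Gamma (α / 2 * ((j + 1 : ℕ) : ℝ) + n / 2)) := by
  unfold coeffStable stieltjesCoeff
  rw [genBinom_neg hβ, show ((n : ℝ) + 2) / 2 = (n : ℝ) / 2 + 1 by ring,
    Real.rpow_add Real.pi_pos, Real.rpow_one, Real.rpow_neg Real.pi_pos.le,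
    show (4 : ℝ) = 2 ^ (2 : ℝ) by norm_num, ← Real.rpow_mul (by norm_num),
    show (α * ((j + 1 : ℕ) : ℝ) + n) / 2 = α / 2 * ((j + 1 : ℕ) : ℝ) + n / 2 by ring,
    show (α * ((j + 1 : ℕ) : ℝ) + 2) / 2 = α / 2 * ((j + 1 : ℕ) : ℝ) + 1 by ring,
    show 2 * (α / 2 * ((j + 1 : ℕ) : ℝ)) = α * ((j + 1 : ℕ) : ℝ) by ring,
    show Real.pi * α * ((j + 1 : ℕ) : ℝ) / 2 = Real.pi * (α / 2) * ((j + 1 : ℕ) : ℝ) by ring,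
    Nat.add_sub_cancel, pow_succ]
  have := (Real.Gamma_pos_of_pos hβ).ne'
  have := Real.pi_pos
  field_simp

theorem hasAsymptoticSeries_heatMixture_stieltjesLaplace {n : ℕ} {α β : ℝ} (hα : 0 < α)
    (hα2 : α < 2) (hβ : 0 < β) :
    HasAsymptoticSeries (Bornology.cobounded (EuclideanSpace ℝ (Fin n)))
      (heatMixture n (stieltjesLaplace (α / 2) β))
      (fun j => coeffStable n α β (j + 1))
      (fun j ω => ‖ω‖ ^ (-(α * ((j + 1 : ℕ) : ℝ)) - (n : ℝ))) := by
  intro N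
  have ha : 0 < α / 2 := by positivity
  have ha1 : α / 2 < 1 := by linarith
  obtain ⟨K, h⟩ := exists_abs_stieltjesLaplace_sub_le ha ha1 hβ N
  refine IsBigO.of_bound (K * (Real.pi ^ (-((n : ℝ) / 2)) * 4 ^ (α / 2 * ((N + 1 : ℕ) : ℝ)) *
        Real.Gamma (α / 2 * ((N + 1 : ℕ) : ℝ) + n / 2))) ?_
  filter_upwards [tendsto_norm_cobounded_atTop.eventually_gt_atTop 0] with ω hω
  have hmom : ∀ j : ℕ, _ := fun j : ℕ => integral_rpow_mul_heatKernel (n := n)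
    (p := α / 2 * ((j + 1 : ℕ) : ℝ)) (by positivity) hω
  obtain ⟨M, hM⟩ := exists_heatKernel_le (n := n) hω
  have hint : IntegrableOn (fun x => stieltjesLaplace (α / 2) β x * heatKernel n x ω)
      (Set.Ioi 0) := by
    refine Integrable.mul_bdd (c := M) (integrableOn_stieltjesLaplace ha ha1 hβ)
      (measurable_heatKernel_left ω).aestronglyMeasurable ?_
    filter_upwards [ae_restrict_mem measurableSet_Ioi] with x hx
    rw [Real.norm_of_nonneg (heatKernel_nonneg hx ω)]
    exact hM x hx ω le_rfl
  have hb := abs_integral_sub_sum_le (N := N) (K := K)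
    (c := fun j => stieltjesCoeff (α / 2) β (j + 1) *
      Real.Gamma (α / 2 * ((j + 1 : ℕ) : ℝ) + 1))
    hint (fun j => (hmom j).1) (hmom N).1 (by
      filter_upwards [ae_restrict_mem measurableSet_Ioi] with x hx
      simp_rw [← mul_assoc]
      rw [← Finset.sum_mul, ← sub_mul, abs_mul, abs_of_nonneg (heatKernel_nonneg hx ω)]
      exact mul_le_mul_of_nonneg_right (h x hx) (heatKernel_nonneg hx ω))
  simp_rw [fun j => (hmom j).2] at hb
  have hexp : ∀ j : ℕ, -(2 * (α / 2 * ((j + 1 : ℕ) : ℝ))) - (n : ℝ) =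
      -(α * ((j + 1 : ℕ) : ℝ)) - n := fun j => by ring
  simp_rw [hexp, ← mul_assoc] at hb
  rw [Real.norm_eq_abs, Real.norm_of_nonneg (by positivity)]
  simp_rw [coeffStable_eq hβ, ← mul_assoc]
  exact hb

theorem isSpectralDensity_gcCov_of_lt_two {n : ℕ} (hn : 0 < n) {α β : ℝ} (hα : 0 < α)
    (hα2 : α < 2) (hβ : 0 < β) :
    IsSpectralDensity (gcCov n α β) (heatMixture n (stieltjesLaplace (α / 2) β)) := by
  have ha : 0 < α / 2 := by positivity
  have ha1 : α / 2 < 1 := by linarith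
  -- In positive dimension the origin is a null set, so only `t ≠ 0`, where `s = ‖t‖² > 0`, has to
  -- be treated.
  have : Nonempty (Fin n) := ⟨⟨0, hn⟩⟩
  refine isSpectralDensity_heatMixture (integrableOn_stieltjesLaplace ha ha1 hβ) ?_
  filter_upwards [Measure.ae_ne volume (0 : EuclideanSpace ℝ (Fin n))] with t ht
  have ht' : 0 < ‖t‖ := norm_pos_iff.2 ht
  rw [integral_stieltjesLaplace_mul_exp ha ha1 hβ (by positivity), gcCov,
    ← Real.rpow_natCast ‖t‖ 2, ← Real.rpow_mul ht'.le]
  congr 3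
  push_cast
  ring

/-! ### The Bessel integral and its expansion -/

/-- The integral `∫₀^∞ x ^ (ν - 1) exp (-x - r² / (4 x)) dx = 2 (r / 2) ^ ν K_ν(r)`, a
normalization of the modified Bessel function of the second kind. -/
def besselIntegral (ν r : ℝ) : ℝ :=
  ∫ x in Set.Ioi 0, x ^ (ν - 1) * Real.exp (-x - r ^ 2 / 4 / x)

theorem integrableOn_besselIntegral (ν : ℝ) {r : ℝ} (hr : 0 < r) :
    IntegrableOn (fun x : ℝ => x ^ (ν - 1) * Real.exp (-x - r ^ 2 / 4 / x)) (Set.Ioi 0) := by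
  have hc : 0 < r ^ 2 / 4 := by positivity
  -- This exponent dominates on both sides of `x = 1`: for `x ≥ 1` against `exp(-x)`, for `x ≤ 1`
  -- against `exp(-r²/(4x))`.
  set p := |ν| + 1 with hp
  have hp0 : 0 < p := by positivity
  have h1 := (integrableOn_rpow_mul_exp_neg_mul hp0 one_pos).add
    (integrableOn_rpow_mul_exp_neg_div hp0 hc)
  refine Integrable.mono' h1 (Measurable.aestronglyMeasurable (by fun_prop)) ?_
  filter_upwards [ae_restrict_mem measurableSet_Ioi] with x hx
  have hx' : 0 < x := hx
  have hcx : 0 < r ^ 2 / 4 / x := by positivity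
  rw [Real.norm_of_nonneg (by positivity)]
  rcases le_total 1 x with h | h
  · refine le_add_of_le_of_nonneg ?_ (by positivity)
    refine mul_le_mul (Real.rpow_le_rpow_of_exponent_le h ?_) (Real.exp_le_exp.2 (by linarith))
      (by positivity) (by positivity)
    linarith [le_abs_self ν]
  · refine le_add_of_nonneg_of_le (by positivity) ?_
    refine mul_le_mul (Real.rpow_le_rpow_of_exponent_ge hx' h ?_) (Real.exp_le_exp.2 (by linarith))
      (by positivity) (by positivity)
    linarith [neg_abs_le ν]

/-- The substitution `x ↦ c / x` with `c = r²/4` exchanges the two exponential terms. It is carried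
out as an inversion on one side and a scaling on the other. -/
theorem besselIntegral_symm (ν : ℝ) {r : ℝ} (hr : 0 < r) :
    besselIntegral ν r = (r ^ 2 / 4) ^ ν * besselIntegral (-ν) r := by
  set c := r ^ 2 / 4 with hc
  have hc0 : 0 < c := by positivity
  unfold besselIntegral
  rw [← hc]
  have h1 := integral_comp_rpow_Ioi (fun x : ℝ => x ^ (ν - 1) * Real.exp (-x - c / x))
    (neg_ne_zero.2 (one_ne_zero (α := ℝ)))
  have h2 := integral_comp_mul_left_Ioi (fun x : ℝ => x ^ (-ν - 1) * Real.exp (-x - c / x)) 0 hc0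
  rw [mul_zero, smul_eq_mul, eq_inv_mul_iff_mul_eq₀ hc0.ne'] at h2
  rw [← h1, ← h2, ← mul_assoc, ← integral_const_mul]
  refine setIntegral_congr_fun measurableSet_Ioi fun x hx => ?_
  have hx' : 0 < x := hx
  simp only [abs_neg, abs_one, one_mul, smul_eq_mul]
  rw [← mul_assoc, ← mul_assoc, ← Real.rpow_mul hx'.le, ← Real.rpow_add hx',
    Real.mul_rpow hc0.le hx'.le, ← mul_assoc, Real.rpow_neg_one]
  have h3 : c ^ ν * c * c ^ (-ν - 1) = 1 := by
    rw [Real.rpow_sub hc0, Real.rpow_neg hc0.le, Real.rpow_one]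
    have := (Real.rpow_pos_of_pos hc0 ν).ne'
    field_simp
  rw [h3, one_mul]
  congr 2
  · ring
  · field_simp
    ring

/-- The Cauchy–Schlömilch substitution: `z = √y - r/(2√y)` is an increasing bijection from the
half-line to `ℝ` and the prefactor is its derivative, so this is the Gaussian integral. -/
theorem integral_exp_neg_sq_comp_sqrt_sub {r : ℝ} (hr : 0 < r) :
    ∫ y in Set.Ioi 0, (1 / 2 * y ^ (-(1 / 2) : ℝ) + r / 4 * y ^ (-(3 / 2) : ℝ)) *
      Real.exp (-(y ^ (1 / 2 : ℝ) - r / 2 * y ^ (-(1 / 2) : ℝ)) ^ 2) = √Real.pi := by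
  set φ : ℝ → ℝ := fun y => y ^ (1 / 2 : ℝ) - r / 2 * y ^ (-(1 / 2) : ℝ) with hφ
  set φ' : ℝ → ℝ := fun y => 1 / 2 * y ^ (-(1 / 2) : ℝ) + r / 4 * y ^ (-(3 / 2) : ℝ) with hφ'
  have hd : ∀ y ∈ Set.Ioi (0 : ℝ), HasDerivAt φ (φ' y) y := by
    intro y hy
    have h1 := Real.hasDerivAt_rpow_const (x := y) (p := 1 / 2) (Or.inl (ne_of_gt hy))
    have h2 := Real.hasDerivAt_rpow_const (x := y) (p := -(1 / 2)) (Or.inl (ne_of_gt hy))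
    refine (h1.sub (h2.const_mul (r / 2))).congr_deriv ?_
    rw [hφ']
    norm_num
    ring
  have hmono : StrictMonoOn φ (Set.Ioi 0) := by
    intro x hx y hy hxy
    have hx' : 0 < x := hx
    have h1 : x ^ (1 / 2 : ℝ) < y ^ (1 / 2 : ℝ) := Real.rpow_lt_rpow hx'.le hxy (by norm_num)
    have h2 : y ^ (-(1 / 2) : ℝ) ≤ x ^ (-(1 / 2) : ℝ) :=
      Real.rpow_le_rpow_of_nonpos hx' hxy.le (by norm_num)
    have h3 : r / 2 * y ^ (-(1 / 2) : ℝ) ≤ r / 2 * x ^ (-(1 / 2) : ℝ) := by gcongr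
    rw [hφ]
    simp only
    linarith
  have himg : φ '' Set.Ioi 0 = Set.univ := by
    refine Set.eq_univ_of_forall fun z => ?_
    -- The positive root of `u² - z u = r/2`; then `y = u²` is the preimage of `z`.
    set u := (z + √(z ^ 2 + 2 * r)) / 2 with hu
    have hsq : √(z ^ 2 + 2 * r) ^ 2 = z ^ 2 + 2 * r := Real.sq_sqrt (by positivity)
    have hlt : |z| < √(z ^ 2 + 2 * r) := Real.lt_sqrt_of_sq_lt (by rw [sq_abs]; linarith)
    have hu0 : 0 < u := by
      have := neg_abs_le z
      rw [hu]
      linarith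
    have huu : u ^ 2 - z * u = r / 2 := by
      rw [hu]
      linear_combination hsq / 4
    refine ⟨u ^ (2 : ℝ), Real.rpow_pos_of_pos hu0 _, ?_⟩
    rw [hφ]
    simp only
    rw [← Real.rpow_mul hu0.le, ← Real.rpow_mul hu0.le]
    norm_num
    rw [Real.rpow_neg_one]
    field_simp
    linear_combination 2 * huu
  have h := integral_image_eq_integral_abs_deriv_smul measurableSet_Ioi
    (fun y hy => (hd y hy).hasDerivWithinAt) hmono.injOn (fun z => Real.exp (-z ^ 2))
  rw [himg, Measure.restrict_univ] at h
  have hG := integral_gaussian 1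
  simp only [neg_mul, one_mul, div_one] at hG
  rw [hG] at h
  rw [h]
  refine setIntegral_congr_fun measurableSet_Ioi fun y hy => ?_
  have hy' : 0 < y := hy
  have : 0 < φ' y := by
    rw [hφ']
    positivity
  rw [abs_of_pos this, smul_eq_mul]

theorem besselIntegral_half {r : ℝ} (hr : 0 < r) :
    besselIntegral (1 / 2) r = √Real.pi * Real.exp (-r) := by
  have hsymm := besselIntegral_symm (1 / 2) hr
  have hc : (r ^ 2 / 4) ^ (1 / 2 : ℝ) = r / 2 := by
    rw [← Real.sqrt_eq_rpow, show r ^ 2 / 4 = (r / 2) ^ 2 by ring, Real.sqrt_sq (by positivity)]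
  rw [hc] at hsymm
  -- Averaging the two orders `±1/2`, related by symmetry, produces exactly the Jacobian of the
  -- substitution; completing the square supplies `exp(-r)`.
  have h1 : besselIntegral (1 / 2) r =
      1 / 2 * besselIntegral (1 / 2) r + r / 4 * besselIntegral (-(1 / 2)) r := by
    linear_combination hsymm / 2
  rw [h1, ← integral_exp_neg_sq_comp_sqrt_sub hr, ← integral_mul_const]
  unfold besselIntegral
  rw [← integral_const_mul, ← integral_const_mul,
    ← integral_add ((integrableOn_besselIntegral _ hr).const_mul _)
      ((integrableOn_besselIntegral _ hr).const_mul _)]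
  refine setIntegral_congr_fun measurableSet_Ioi fun y hy => ?_
  have hy' : 0 < y := hy
  have hE : Real.exp (-(y ^ (1 / 2 : ℝ) - r / 2 * y ^ (-(1 / 2) : ℝ)) ^ 2) * Real.exp (-r) =
      Real.exp (-y - r ^ 2 / 4 / y) := by
    rw [← Real.exp_add]
    congr 1
    have e1 : y ^ (1 / 2 : ℝ) * y ^ (-(1 / 2) : ℝ) = 1 := by
      rw [← Real.rpow_add hy']
      norm_num
    have e2 : y ^ (1 / 2 : ℝ) * y ^ (1 / 2 : ℝ) = y := by
      rw [← Real.rpow_add hy']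
      norm_num
    have e3 : y ^ (-(1 / 2) : ℝ) * y ^ (-(1 / 2) : ℝ) = y⁻¹ := by
      rw [← Real.rpow_add hy', ← Real.rpow_neg_one]
      norm_num
    rw [div_eq_mul_inv (r ^ 2 / 4), ← e3]
    linear_combination r * e1 - e2
  rw [mul_assoc _ _ (Real.exp (-r)), hE]
  norm_num
  ring

theorem integral_rpow_mul_exp_neg_sub_div {q r : ℝ} (hq : 0 < q) (hr : 0 < r) :
    ∫ y in Set.Ioi 0, y ^ (1 / 2 - 1 : ℝ) * Real.exp (-(q * y) - r ^ 2 / 4 / y) =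
      √Real.pi * Real.exp (-(r * √q)) / √q := by
  have hs : 0 < √q := Real.sqrt_pos.2 hq
  have hqs : √q ^ 2 = q := Real.sq_sqrt hq.le
  have h := integral_comp_mul_left_Ioi
    (fun x : ℝ => x ^ (1 / 2 - 1 : ℝ) * Real.exp (-x - (r * √q) ^ 2 / 4 / x)) 0 hq
  rw [mul_zero, smul_eq_mul] at h
  have hb := besselIntegral_half (r := r * √q) (by positivity)
  unfold besselIntegral at hb
  rw [hb] at h
  have heq : ∀ y ∈ Set.Ioi (0 : ℝ), (q * y) ^ (1 / 2 - 1 : ℝ) *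
      Real.exp (-(q * y) - (r * √q) ^ 2 / 4 / (q * y)) =
      (√q)⁻¹ * (y ^ (1 / 2 - 1 : ℝ) * Real.exp (-(q * y) - r ^ 2 / 4 / y)) := by
    intro y hy
    have hy' : 0 < y := hy
    rw [Real.mul_rpow hq.le hy'.le, mul_assoc, Real.sqrt_eq_rpow, ← Real.rpow_neg hq.le,
      ← Real.sqrt_eq_rpow, mul_pow, hqs]
    congr 2
    · norm_num
    · congr 2
      field_simp
  rw [setIntegral_congr_fun measurableSet_Ioi heq, integral_const_mul] at h
  have hinv : q⁻¹ * √q = (√q)⁻¹ := by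
    nth_rewrite 1 [← hqs]
    field_simp
  rw [eq_div_iff hs.ne']
  refine mul_left_cancel₀ (inv_pos.2 hq).ne' ?_
  rw [← h, ← hinv]
  ring

/-- Writing `Γ(μ) y^(-μ)` as `∫ q^(μ-1) exp(-yq) dq` and exchanging integrals reduces any order
below `1/2` to the explicit order `1/2`. -/
theorem besselIntegral_mul_Gamma {μ r : ℝ} (hμ : 0 < μ) (hr : 0 < r) :
    Real.Gamma μ * besselIntegral (1 / 2 - μ) r =
      ∫ q in Set.Ioi 0, q ^ (μ - 1) * (√Real.pi * Real.exp (-(r * √(1 + q))) / √(1 + q)) := by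
  have hm : Measurable (fun p : ℝ × ℝ => p.1 ^ (1 / 2 - 1 : ℝ) *
      Real.exp (-p.1 - r ^ 2 / 4 / p.1) * (p.2 ^ (μ - 1) * Real.exp (-(p.1 * p.2)))) := by
    fun_prop
  have hinner : ∀ y ∈ Set.Ioi (0 : ℝ), ∫ q in Set.Ioi 0, y ^ (1 / 2 - 1 : ℝ) *
      Real.exp (-y - r ^ 2 / 4 / y) * (q ^ (μ - 1) * Real.exp (-(y * q))) =
      Real.Gamma μ * (y ^ (1 / 2 - μ - 1) * Real.exp (-y - r ^ 2 / 4 / y)) := by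
    intro y hy
    have hy' : 0 < y := hy
    rw [integral_const_mul, Real.integral_rpow_mul_exp_neg_mul_Ioi hμ hy', one_div (y : ℝ),
      Real.inv_rpow hy'.le, ← Real.rpow_neg hy'.le,
      show 1 / 2 - μ - 1 = (1 / 2 - 1) + -μ by ring, Real.rpow_add hy']
    ring
  have hint : Integrable (fun p : ℝ × ℝ => p.1 ^ (1 / 2 - 1 : ℝ) *
      Real.exp (-p.1 - r ^ 2 / 4 / p.1) * (p.2 ^ (μ - 1) * Real.exp (-(p.1 * p.2))))
      ((volume.restrict (Set.Ioi 0)).prod (volume.restrict (Set.Ioi 0))) := by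
    rw [integrable_prod_iff hm.aestronglyMeasurable]
    constructor
    · filter_upwards [ae_restrict_mem measurableSet_Ioi] with y hy
      exact (integrableOn_rpow_mul_exp_neg_mul hμ hy).const_mul _
    · refine IntegrableOn.congr_fun ((integrableOn_besselIntegral (1 / 2 - μ) hr).const_mul
        (Real.Gamma μ)) (fun y hy => ?_) measurableSet_Ioi
      have hy' : 0 < y := hy
      simp only
      rw [← hinner y hy]
      refine setIntegral_congr_fun measurableSet_Ioi fun q hq => ?_
      have hq' : 0 < q := hq
      exact (Real.norm_of_nonneg (by positivity)).symm
  unfold besselIntegral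
  rw [← integral_const_mul, ← setIntegral_congr_fun measurableSet_Ioi hinner,
    integral_integral_swap hint]
  refine setIntegral_congr_fun measurableSet_Ioi fun q hq => ?_
  have hq' : 0 < q := hq
  rw [← integral_rpow_mul_exp_neg_sub_div (by positivity) hr, ← integral_const_mul]
  refine integral_congr_ae (.of_forall fun y => ?_)
  simp only
  rw [show -((1 + q) * y) - r ^ 2 / 4 / y = (-y - r ^ 2 / 4 / y) + -(y * q) by ring, Real.exp_add]
  ring

/-- The substitution `1 + q = (1 + w)²` removes the square root, making the exponent linear and
splitting off `exp(-r)`. -/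
theorem besselIntegral_eq_laplace {μ r : ℝ} (hμ : 0 < μ) (hr : 0 < r) :
    Real.Gamma μ * besselIntegral (1 / 2 - μ) r = √Real.pi * 2 ^ μ * Real.exp (-r) *
      ∫ w in Set.Ioi 0, w ^ (μ - 1) * (1 + w / 2) ^ (μ - 1) * Real.exp (-(r * w)) := by
  have hd : ∀ w ∈ Set.Ioi (0 : ℝ), HasDerivWithinAt (fun w : ℝ => w ^ 2 + 2 * w) (2 * w + 2)
      (Set.Ioi 0) w := by
    intro w _
    refine (((hasDerivAt_id w).pow 2).add ((hasDerivAt_id w).const_mul 2)).hasDerivWithinAt.congr_deriv ?_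
    simp
  have hinj : Set.InjOn (fun w : ℝ => w ^ 2 + 2 * w) (Set.Ioi 0) := by
    intro x hx y hy hxy
    have hx' : 0 < x := hx
    have hy' : 0 < y := hy
    have h : (x - y) * (x + y + 2) = 0 := by
      simp only at hxy
      linear_combination hxy
    rcases mul_eq_zero.1 h with h | h <;> linarith
  have himg : (fun w : ℝ => w ^ 2 + 2 * w) '' Set.Ioi 0 = Set.Ioi 0 := by
    ext q
    constructor
    · rintro ⟨w, hw, rfl⟩
      have hw' : 0 < w := hw
      exact Set.mem_Ioi.2 (by positivity)
    · intro hq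
      have hq' : 0 < q := hq
      refine ⟨√(1 + q) - 1, ?_, ?_⟩
      · exact Set.mem_Ioi.2 (sub_pos.2 (Real.lt_sqrt_of_sq_lt (by linarith)))
      · have := Real.sq_sqrt (show 0 ≤ 1 + q by positivity)
        simp only
        linear_combination this
  rw [besselIntegral_mul_Gamma hμ hr, ← himg,
    integral_image_eq_integral_abs_deriv_smul measurableSet_Ioi hd hinj, himg, ← integral_const_mul]
  refine setIntegral_congr_fun measurableSet_Ioi fun w hw => ?_
  have hw' : 0 < w := hw
  rw [show 1 + (w ^ 2 + 2 * w) = (1 + w) ^ 2 by ring, Real.sqrt_sq (by positivity),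
    abs_of_pos (by positivity), smul_eq_mul,
    show w ^ 2 + 2 * w = 2 * (w * (1 + w / 2)) by ring,
    Real.mul_rpow (by norm_num) (by positivity), Real.mul_rpow hw'.le (by positivity),
    Real.rpow_sub two_pos, Real.rpow_one, show -(r * (1 + w)) = -r + -(r * w) by ring,
    Real.exp_add]
  field_simp
  ring

/-- Of the `2j` factors of `gammaRatio`, the lower half read backwards is the binomial numerator and
the upper half is `Γ(μ + j) / Γ(μ)`. -/
theorem genBinom_mul_Gamma {μ : ℝ} (hμ : 0 < μ) (j : ℕ) :
    genBinom (μ - 1) j * Real.Gamma (μ + j) = Real.Gamma μ * (gammaRatio μ j / j.factorial) := by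
  unfold genBinom gammaRatio
  rw [Gamma_add_natCast_eq_prod μ j fun i _ => by positivity, two_mul, Finset.prod_range_add,
    ← Finset.prod_range_reflect (fun i : ℕ => μ - j + (i : ℝ))]
  have h1 : ∏ i ∈ Finset.range j, (μ - 1 - i) =
      ∏ i ∈ Finset.range j, (μ - j + ((j - 1 - i : ℕ) : ℝ)) := by
    refine Finset.prod_congr rfl fun i hi => ?_
    have hi' := Finset.mem_range.1 hi
    rw [Nat.cast_sub (by omega), Nat.cast_sub (by omega)]
    push_cast
    ring
  have h2 : ∏ i ∈ Finset.range j, (μ - j + ((j + i : ℕ) : ℝ)) =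
      ∏ i ∈ Finset.range j, (μ + i) := by
    refine Finset.prod_congr rfl fun i _ => ?_
    push_cast
    ring
  rw [h1, h2]
  ring

/-- Reflection reverses the factors and negates each; their number is even. -/
theorem gammaRatio_one_sub (a : ℝ) (j : ℕ) : gammaRatio (1 - a) j = gammaRatio a j := by
  unfold gammaRatio
  rw [← Finset.prod_range_reflect (fun i : ℕ => a - j + (i : ℝ))]
  have h : ∀ i ∈ Finset.range (2 * j), 1 - a - j + (i : ℝ) =
      -1 * (a - j + ((2 * j - 1 - i : ℕ) : ℝ)) := by
    intro i hi
    have hi' := Finset.mem_range.1 hi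
    rw [Nat.cast_sub (by omega), Nat.cast_sub (by omega)]
    push_cast
    ring
  rw [Finset.prod_congr rfl h, Finset.prod_mul_distrib, Finset.prod_const, Finset.card_range]
  simp

theorem exists_abs_besselIntegral_sub_le_of_pos {μ : ℝ} (hμ : 0 < μ) (N : ℕ) :
    ∃ K : ℝ, ∀ r : ℝ, 1 ≤ r →
      |besselIntegral (1 / 2 - μ) r - ∑ j ∈ Finset.range N,
        gammaRatio μ j / (j.factorial : ℝ) *
          (√Real.pi * 2 ^ μ * Real.exp (-r) * r ^ (-μ) * (1 / (2 * r) ^ j))| ≤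
        K * (Real.exp (-r) * r ^ (-μ) * (1 / (2 * r) ^ N)) := by
  obtain ⟨K₀, hK₀, h₀⟩ := exists_one_add_rpow_le_exp (μ - 1)
  obtain ⟨K, hK, h⟩ := exists_abs_binomial_remainder_le (μ - 1) N
  have hΓ := Real.Gamma_pos_of_pos hμ
  refine ⟨(Real.Gamma μ)⁻¹ * (√Real.pi * 2 ^ μ * (K * (2 ^ (μ + N) * 2 ^ N * Real.Gamma (μ + N)))),
    fun r hr => ?_⟩
  have hr0 : 0 < r := by linarith
  have hpow : ∀ j : ℕ, ∀ ρ : ℝ, 0 < ρ → _ := fun (j : ℕ) ρ (hρ : 0 < ρ) =>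
    And.intro (integrableOn_rpow_mul_exp_neg_mul (p := μ + j) (by positivity) hρ)
      (Real.integral_rpow_mul_exp_neg_mul_Ioi (a := μ + j) (by positivity) hρ)
  -- The growth `exp(w/2)` of the binomial remainder costs half of the decay, as `r ≥ 1`. The
  -- resulting rate `r/2` is the source of `2^(μ+N)` in the constant; `2^N` converts `r^N` to
  -- `(2r)^N`.
  have hexp : ∀ w : ℝ, 0 < w → Real.exp (w / 2) * Real.exp (-(r * w)) ≤
      Real.exp (-(r / 2 * w)) := by
    intro w hw
    rw [← Real.exp_add]
    refine Real.exp_le_exp.2 ?_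
    nlinarith
  have hint : IntegrableOn (fun w : ℝ => w ^ (μ - 1) * (1 + w / 2) ^ (μ - 1) *
      Real.exp (-(r * w))) (Set.Ioi 0) := by
    refine Integrable.mono' ((integrableOn_rpow_mul_exp_neg_mul hμ (half_pos hr0)).const_mul K₀)
      (Measurable.aestronglyMeasurable (by fun_prop)) ?_
    filter_upwards [ae_restrict_mem measurableSet_Ioi] with w hw
    have hw' : 0 < w := hw
    rw [Real.norm_of_nonneg (by positivity)]
    calc w ^ (μ - 1) * (1 + w / 2) ^ (μ - 1) * Real.exp (-(r * w))
        ≤ w ^ (μ - 1) * (K₀ * Real.exp (w / 2)) * Real.exp (-(r * w)) := by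
          gcongr
          exact h₀ _ (by positivity)
      _ = K₀ * (w ^ (μ - 1) * (Real.exp (w / 2) * Real.exp (-(r * w)))) := by ring
      _ ≤ _ := by
          gcongr
          exact hexp w hw'
  have hterm : ∀ (w : ℝ) (j : ℕ), 0 < w → w ^ (μ + j - 1) = w ^ (μ - 1) * w ^ j := by
    intro w j hw
    rw [← Real.rpow_natCast, ← Real.rpow_add hw]
    ring_nf
  have hb := abs_integral_sub_sum_le (N := N) (K := K) (c := fun j => genBinom (μ - 1) j / 2 ^ j)
    hint (fun j => (hpow j r hr0).1) (hpow N (r / 2) (half_pos hr0)).1 (by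
      filter_upwards [ae_restrict_mem measurableSet_Ioi] with w hw
      have hw' : 0 < w := hw
      have hfac : w ^ (μ - 1) * (1 + w / 2) ^ (μ - 1) * Real.exp (-(r * w)) -
          ∑ j ∈ Finset.range N, genBinom (μ - 1) j / 2 ^ j *
            (w ^ (μ + j - 1) * Real.exp (-(r * w))) =
          w ^ (μ - 1) * Real.exp (-(r * w)) * ((1 + w / 2) ^ (μ - 1) -
            ∑ j ∈ Finset.range N, genBinom (μ - 1) j * (w / 2) ^ j) := by
        rw [mul_sub, Finset.mul_sum]
        congr 1
        · ring
        · refine Finset.sum_congr rfl fun j _ => ?_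
          rw [hterm w j hw', div_pow]
          ring
      rw [hfac, abs_mul, abs_of_pos (by positivity)]
      calc w ^ (μ - 1) * Real.exp (-(r * w)) * _
          ≤ w ^ (μ - 1) * Real.exp (-(r * w)) * (K * (w / 2) ^ N * Real.exp (w / 2)) := by
            gcongr
            exact h _ (by positivity)
        _ = K * ((w ^ (μ - 1) * (w / 2) ^ N) * (Real.exp (w / 2) * Real.exp (-(r * w)))) := by ring
        _ ≤ K * (w ^ (μ + N - 1) * Real.exp (-(r / 2 * w))) := by
            rw [hterm w N hw']
            gcongr
            · linarith
            · exact hexp w hw')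
  simp_rw [fun j => (hpow j r hr0).2] at hb
  rw [(hpow N (r / 2) (half_pos hr0)).2] at hb
  have hscale : ∀ (j : ℕ), (1 / r) ^ (μ + j) = r ^ (-μ) * (1 / r ^ j) := by
    intro j
    rw [one_div, Real.inv_rpow hr0.le, Real.rpow_add hr0, Real.rpow_natCast, Real.rpow_neg hr0.le]
    field_simp
  have hlap := besselIntegral_eq_laplace hμ hr0
  set W := ∫ w in Set.Ioi 0, w ^ (μ - 1) * (1 + w / 2) ^ (μ - 1) * Real.exp (-(r * w)) with hW
  set A := √Real.pi * 2 ^ μ * Real.exp (-r) with hA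
  have hA0 : 0 ≤ A := by positivity
  have hI : besselIntegral (1 / 2 - μ) r = (Real.Gamma μ)⁻¹ * (A * W) := by
    rw [← hlap]
    field_simp
  have hsum : ∑ j ∈ Finset.range N, gammaRatio μ j / (j.factorial : ℝ) *
      (A * r ^ (-μ) * (1 / (2 * r) ^ j)) = (Real.Gamma μ)⁻¹ * (A *
        ∑ j ∈ Finset.range N, genBinom (μ - 1) j / 2 ^ j *
          ((1 / r) ^ (μ + j) * Real.Gamma (μ + j))) := by
    rw [Finset.mul_sum, Finset.mul_sum]
    refine Finset.sum_congr rfl fun j _ => ?_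
    rw [hscale, show genBinom (μ - 1) j / 2 ^ j * (r ^ (-μ) * (1 / r ^ j) * Real.Gamma (μ + j)) =
      genBinom (μ - 1) j * Real.Gamma (μ + j) * (r ^ (-μ) * (1 / r ^ j) / 2 ^ j) by ring,
      genBinom_mul_Gamma hμ, mul_pow]
    field_simp
  rw [hsum, hI, ← mul_sub, ← mul_sub, abs_mul, abs_mul, abs_of_pos (inv_pos.2 hΓ),
    abs_of_nonneg hA0]
  have hlast : (1 / (r / 2)) ^ (μ + N) = 2 ^ (μ + N) * (r ^ (-μ) * (1 / r ^ N)) := by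
    rw [← hscale, ← Real.mul_rpow (by norm_num) (by positivity)]
    congr 1
    field_simp
  rw [hlast] at hb
  refine (mul_le_mul_of_nonneg_left (mul_le_mul_of_nonneg_left hb hA0)
    (inv_pos.2 hΓ).le).trans (le_of_eq ?_)
  rw [hA, mul_pow]
  field_simp

theorem exists_abs_besselIntegral_sub_le (a : ℝ) (N : ℕ) :
    ∃ K : ℝ, ∀ r : ℝ, 1 ≤ r →
      |besselIntegral (1 / 2 - a) r - ∑ j ∈ Finset.range N,
        gammaRatio a j / (j.factorial : ℝ) *
          (√Real.pi * 2 ^ a * Real.exp (-r) * r ^ (-a) * (1 / (2 * r) ^ j))| ≤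
        K * (Real.exp (-r) * r ^ (-a) * (1 / (2 * r) ^ N)) := by
  rcases lt_or_ge 0 a with ha | ha
  · exact exists_abs_besselIntegral_sub_le_of_pos ha N
  obtain ⟨K, h⟩ := exists_abs_besselIntegral_sub_le_of_pos (μ := 1 - a) (by linarith) N
  refine ⟨2 ^ (2 * a - 1) * K, fun r hr => ?_⟩
  have hr0 : 0 < r := by linarith
  have hc : (r ^ 2 / 4) ^ (1 / 2 - a) = r ^ (1 - 2 * a) * 2 ^ (2 * a - 1) := by
    rw [show r ^ 2 / 4 = (r / 2) ^ (2 : ℝ) by norm_num; ring, ← Real.rpow_mul (by positivity),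
      Real.div_rpow hr0.le (by norm_num), div_eq_mul_inv, ← Real.rpow_neg (by norm_num)]
    ring_nf
  have h2 : (2 : ℝ) ^ (2 * a - 1) * 2 ^ (1 - a) = 2 ^ a := by
    rw [← Real.rpow_add two_pos]
    ring_nf
  have hr2 : r ^ (1 - 2 * a) * r ^ (-(1 - a)) = r ^ (-a) := by
    rw [← Real.rpow_add hr0]
    ring_nf
  have hb := mul_le_mul_of_nonneg_left (h r hr)
    (show 0 ≤ (r ^ 2 / 4) ^ (1 / 2 - a) by positivity)
  rw [besselIntegral_symm _ hr0, show -(1 / 2 - a) = 1 / 2 - (1 - a) by ring]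
  rw [← abs_of_nonneg (show 0 ≤ (r ^ 2 / 4) ^ (1 / 2 - a) by positivity), ← abs_mul, mul_sub,
    Finset.mul_sum, abs_of_nonneg (show 0 ≤ (r ^ 2 / 4) ^ (1 / 2 - a) by positivity)] at hb
  refine le_of_eq_of_le ?_ (hb.trans_eq ?_)
  · congr 2
    refine Finset.sum_congr rfl fun j _ => ?_
    rw [hc, gammaRatio_one_sub, ← h2, ← hr2]
    ring
  · rw [hc, ← hr2]
    ring

/-! ### The expansion for `α = 2` -/

/-- The density of the Gamma distribution with shape `β` and rate `1`. -/
def gammaDensity (β x : ℝ) : ℝ :=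
  (Real.Gamma β)⁻¹ * (x ^ (β - 1) * Real.exp (-(1 * x)))

theorem integrableOn_gammaDensity {β : ℝ} (hβ : 0 < β) :
    IntegrableOn (gammaDensity β) (Set.Ioi 0) :=
  (integrableOn_rpow_mul_exp_neg_mul hβ one_pos).const_mul _

theorem isSpectralDensity_gcCov_two {n : ℕ} {β : ℝ} (hβ : 0 < β) :
    IsSpectralDensity (gcCov n 2 β) (heatMixture n (gammaDensity β)) := by
  refine isSpectralDensity_heatMixture (integrableOn_gammaDensity hβ) (.of_forall fun t => ?_)
  have heq : ∀ x : ℝ, gammaDensity β x * Real.exp (-(x * ‖t‖ ^ 2)) =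
      (Real.Gamma β)⁻¹ * (x ^ (β - 1) * Real.exp (-((1 + ‖t‖ ^ 2) * x))) := by
    intro x
    unfold gammaDensity
    rw [mul_assoc, mul_assoc, ← Real.exp_add]
    ring_nf
  have h1 : 0 < 1 + ‖t‖ ^ 2 := by positivity
  simp_rw [heq]
  rw [integral_const_mul, Real.integral_rpow_mul_exp_neg_mul_Ioi hβ h1, gcCov, one_div,
    Real.inv_rpow h1.le, ← Real.rpow_neg h1.le, Real.rpow_two]
  have := (Real.Gamma_pos_of_pos hβ).ne'
  field_simp

theorem heatMixture_gammaDensity {n : ℕ} {β : ℝ} (ω : EuclideanSpace ℝ (Fin n)) :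
    heatMixture n (gammaDensity β) ω =
      (Real.Gamma β)⁻¹ * (4 * Real.pi) ^ (-((n : ℝ) / 2)) *
        besselIntegral (1 / 2 - (((n : ℝ) + 1) / 2 - β)) ‖ω‖ := by
  unfold heatMixture besselIntegral
  rw [← integral_const_mul]
  refine setIntegral_congr_fun measurableSet_Ioi fun x hx => ?_
  have hx' : 0 < x := hx
  unfold gammaDensity heatKernel
  rw [Real.mul_rpow (by positivity) hx'.le, div_div,
    show 1 / 2 - (((n : ℝ) + 1) / 2 - β) - 1 = (β - 1) + -((n : ℝ) / 2) by ring,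
    Real.rpow_add hx', sub_eq_add_neg (-x), Real.exp_add, one_mul]
  ring

theorem prefactorTwo_eq {n : ℕ} {β r : ℝ} :
    prefactorTwo n β r = (Real.Gamma β)⁻¹ * (4 * Real.pi) ^ (-((n : ℝ) / 2)) *
      (√Real.pi * 2 ^ (((n : ℝ) + 1) / 2 - β) * Real.exp (-r) *
        r ^ (-(((n : ℝ) + 1) / 2 - β))) := by
  have hpi := Real.pi_pos
  have h1 : (4 * Real.pi) ^ (-((n : ℝ) / 2)) * (√Real.pi * 2 ^ (((n : ℝ) + 1) / 2 - β)) =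
      (2 ^ (((n : ℝ) - 1) / 2 + β) * Real.pi ^ (((n : ℝ) - 1) / 2))⁻¹ := by
    rw [Real.mul_rpow (by norm_num) hpi.le, mul_inv, ← Real.rpow_neg (by norm_num),
      ← Real.rpow_neg hpi.le, Real.sqrt_eq_rpow, show (4 : ℝ) = 2 ^ (2 : ℝ) by norm_num,
      ← Real.rpow_mul (by norm_num),
      show -(((n : ℝ) - 1) / 2 + β) = 2 * -((n : ℝ) / 2) + (((n : ℝ) + 1) / 2 - β) by ring,
      show -(((n : ℝ) - 1) / 2) = -((n : ℝ) / 2) + 1 / 2 by ring, Real.rpow_add hpi,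
      Real.rpow_add two_pos]
    ring
  unfold prefactorTwo
  rw [show (Real.Gamma β)⁻¹ * (4 * Real.pi) ^ (-((n : ℝ) / 2)) *
      (√Real.pi * 2 ^ (((n : ℝ) + 1) / 2 - β) * Real.exp (-r) *
        r ^ (-(((n : ℝ) + 1) / 2 - β))) = (Real.Gamma β)⁻¹ *
      ((4 * Real.pi) ^ (-((n : ℝ) / 2)) * (√Real.pi * 2 ^ (((n : ℝ) + 1) / 2 - β))) *
        (Real.exp (-r) * r ^ (-(((n : ℝ) + 1) / 2 - β))) by ring, h1, neg_sub, div_eq_mul_inv,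
    mul_inv (_ * _) (Real.Gamma β)]
  ring

theorem hasAsymptoticSeries_heatMixture_gammaDensity {n : ℕ} {β : ℝ} (hβ : 0 < β) :
    HasAsymptoticSeries (Bornology.cobounded (EuclideanSpace ℝ (Fin n)))
      (heatMixture n (gammaDensity β))
      (fun j => gammaRatio (((n : ℝ) + 1) / 2 - β) j / (j.factorial : ℝ))
      (fun j ω => prefactorTwo n β ‖ω‖ * (1 / (2 * ‖ω‖) ^ j)) := by
  intro N
  set a := ((n : ℝ) + 1) / 2 - β with ha
  obtain ⟨K, h⟩ := exists_abs_besselIntegral_sub_le a N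
  refine IsBigO.of_bound (K * (√Real.pi * 2 ^ a)⁻¹) ?_
  filter_upwards [tendsto_norm_cobounded_atTop.eventually_ge_atTop 1] with ω hω
  have hω0 : 0 < ‖ω‖ := by linarith
  have hΓ := Real.Gamma_pos_of_pos hβ
  set C := (Real.Gamma β)⁻¹ * (4 * Real.pi) ^ (-((n : ℝ) / 2)) with hC
  have hC0 : 0 < C := by positivity
  have hb := mul_le_mul_of_nonneg_left (h ‖ω‖ hω) hC0.le
  have hpre : prefactorTwo n β ‖ω‖ =
      C * (√Real.pi * 2 ^ a * Real.exp (-‖ω‖) * ‖ω‖ ^ (-a)) := prefactorTwo_eq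
  have hlhs : heatMixture n (gammaDensity β) ω - ∑ j ∈ Finset.range N,
      gammaRatio a j / (j.factorial : ℝ) * (prefactorTwo n β ‖ω‖ * (1 / (2 * ‖ω‖) ^ j)) =
      C * (besselIntegral (1 / 2 - a) ‖ω‖ - ∑ j ∈ Finset.range N,
        gammaRatio a j / (j.factorial : ℝ) *
          (√Real.pi * 2 ^ a * Real.exp (-‖ω‖) * ‖ω‖ ^ (-a) * (1 / (2 * ‖ω‖) ^ j))) := by
    rw [heatMixture_gammaDensity, mul_sub, Finset.mul_sum, hpre]
    congr 1
    refine Finset.sum_congr rfl fun j _ => ?_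
    ring
  rw [hlhs, norm_mul, Real.norm_of_nonneg hC0.le, Real.norm_eq_abs]
  refine hb.trans (le_of_eq ?_)
  rw [hpre, Real.norm_of_nonneg (by positivity)]
  have hp : √Real.pi ≠ 0 := (Real.sqrt_pos.2 Real.pi_pos).ne'
  field_simp

/-! ### Leading terms and conclusion -/

theorem HasAsymptoticSeries.isEquivalent {E : Type*} {l : Filter E} {f : E → ℝ} {a : ℕ → ℝ}
    {φ : ℕ → E → ℝ} (h : HasAsymptoticSeries l f a φ) (h0 : a 0 ≠ 0) (hφ : φ 1 =o[l] φ 0) :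
    f ~[l] fun x => a 0 * φ 0 x := by
  have h1 := (h 1).trans_isLittleO hφ
  simp only [Finset.sum_range_one] at h1
  exact h1.const_mul_right h0

theorem HasAsymptoticSeries.congr {E : Type*} {l : Filter E} {f g : E → ℝ} {a : ℕ → ℝ}
    {φ : ℕ → E → ℝ} (h : HasAsymptoticSeries l f a φ) (hfg : f =ᶠ[l] g) :
    HasAsymptoticSeries l g a φ := fun N =>
  (h N).congr' (hfg.mono fun x hx => by simp only [hx]) .rfl

theorem coeffStable_one {n : ℕ} {α β : ℝ} (hβ : 0 < β) :
    coeffStable n α β 1 = 2 ^ α * β / Real.pi ^ (((n : ℝ) + 2) / 2) * Real.Gamma ((α + n) / 2) *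
      Real.Gamma ((α + 2) / 2) * Real.sin (Real.pi * α / 2) := by
  unfold coeffStable
  have := (Real.Gamma_pos_of_pos hβ).ne'
  simp only [Nat.sub_self, pow_zero, Nat.cast_one, mul_one, Nat.factorial_one, div_one, one_mul,
    Real.Gamma_add_one hβ.ne']
  field_simp

theorem coeffStable_one_ne_zero {n : ℕ} {α β : ℝ} (hα : 0 < α) (hα2 : α < 2) (hβ : 0 < β) :
    coeffStable n α β 1 ≠ 0 := by
  rw [coeffStable_one hβ]
  have hpi := Real.pi_pos
  have h1 := Real.Gamma_pos_of_pos (s := (α + n) / 2) (by positivity)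
  have h2 := Real.Gamma_pos_of_pos (s := (α + 2) / 2) (by positivity)
  have h3 : 0 < Real.sin (Real.pi * α / 2) :=
    Real.sin_pos_of_pos_of_lt_pi (by positivity) (by nlinarith)
  positivity

end

theorem proposition3p2 (n : ℕ) (hn : 0 < n) (α β : ℝ) (hα : 0 < α) (hα2 : α ≤ 2) (hβ : 0 < β) :
    (∃ S : EuclideanSpace ℝ (Fin n) → ℝ, IsSpectralDensity (gcCov n α β) S) ∧
    ∀ S : EuclideanSpace ℝ (Fin n) → ℝ, IsSpectralDensity (gcCov n α β) S →
      (α < 2 →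
        -- the series `∑_{j ≥ 1}`, indexed from `0` by `j ↦ j + 1`
        HasAsymptoticSeries (Bornology.cobounded (EuclideanSpace ℝ (Fin n))) S
          (fun j => coeffStable n α β (j + 1))
          (fun j ω => ‖ω‖ ^ (-(α * ((j + 1 : ℕ) : ℝ)) - (n : ℝ))) ∧
        S ~[Bornology.cobounded (EuclideanSpace ℝ (Fin n))] fun ω =>
          2 ^ α * β / Real.pi ^ (((n : ℝ) + 2) / 2) * Real.Gamma ((α + n) / 2) *
            Real.Gamma ((α + 2) / 2) * Real.sin (Real.pi * α / 2) * ‖ω‖ ^ (-α - (n : ℝ))) ∧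
      (α = 2 →
        HasAsymptoticSeries (Bornology.cobounded (EuclideanSpace ℝ (Fin n))) S
          (fun j => gammaRatio (((n : ℝ) + 1) / 2 - β) j / (j.factorial : ℝ))
          (fun j ω => prefactorTwo n β ‖ω‖ * (1 / (2 * ‖ω‖) ^ j)) ∧
        S ~[Bornology.cobounded (EuclideanSpace ℝ (Fin n))] fun ω => prefactorTwo n β ‖ω‖) := by
  have hne : ∀ᶠ ω : EuclideanSpace ℝ (Fin n) in Bornology.cobounded _, ω ≠ 0 :=
    (tendsto_norm_cobounded_atTop.eventually_gt_atTop 0).mono fun ω hω => norm_pos_iff.1 hω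
  refine ⟨?_, fun S hS => ⟨fun hlt => ?_, fun heq => ?_⟩⟩
  · rcases hα2.lt_or_eq with hlt | rfl
    · exact ⟨_, isSpectralDensity_gcCov_of_lt_two hn hα hlt hβ⟩
    · exact ⟨_, isSpectralDensity_gcCov_two hβ⟩
  · have hser := (hasAsymptoticSeries_heatMixture_stieltjesLaplace (n := n) hα hlt hβ).congr
      (hne.mono fun ω hω =>
        (isSpectralDensity_gcCov_of_lt_two hn hα hlt hβ).eq_of_ne_zero hS hω)
    refine ⟨hser, ?_⟩
    have h := hser.isEquivalent (coeffStable_one_ne_zero hα hlt hβ) ?_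
    · simpa [coeffStable_one hβ] using h
    · have hlim : Tendsto (fun ω : EuclideanSpace ℝ (Fin n) => ‖ω‖ ^ (-α))
          (Bornology.cobounded _) (𝓝 0) :=
        (tendsto_rpow_neg_atTop hα).comp tendsto_norm_cobounded_atTop
      refine isLittleO_of_tendsto' (hne.mono fun ω hω h0 => ?_) (hlim.congr' (hne.mono fun ω hω => ?_))
      · exact absurd h0 (Real.rpow_pos_of_pos (norm_pos_iff.2 hω) _).ne'
      · simp only
        rw [← Real.rpow_sub (norm_pos_iff.2 hω)]
        congr 1
        push_cast
        ring
  · subst heq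
    have hser := (hasAsymptoticSeries_heatMixture_gammaDensity (n := n) hβ).congr
      (hne.mono fun ω hω => (isSpectralDensity_gcCov_two hβ).eq_of_ne_zero hS hω)
    refine ⟨hser, ?_⟩
    have h := hser.isEquivalent (by simp [gammaRatio]) ?_
    · simpa [gammaRatio] using h
    · have hlim : Tendsto (fun ω : EuclideanSpace ℝ (Fin n) => 1 / (2 * ‖ω‖))
          (Bornology.cobounded _) (𝓝 0) := by
        simp_rw [one_div]
        exact tendsto_inv_atTop_zero.comp (tendsto_norm_cobounded_atTop.const_mul_atTop two_pos)
      have := (isBigO_refl (fun ω : EuclideanSpace ℝ (Fin n) => prefactorTwo n β ‖ω‖)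
        (Bornology.cobounded _)).mul_isLittleO ((isLittleO_one_iff ℝ).2 hlim)
      simpa using this
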